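/- **Lemma 4.1.** There is a polynomial-time algorithm with the following property. Let $k\ge 1$ and $\gamma\ge 1$ be integers, and let $G$ be a finite $k$-edge-connected multigraph (loops and parallel edges allowed; $G$ is nonempty and stays connected after deleting any fewer than $k$ edges), given with a cellular embedding, described by its rotation system, in a closed connected orientable surface of genus at most $\gamma$; let $G^*$ be its geometric dual. On input $G$ (with its rotation system), $k$ and $\gamma$, the algorithm deletes some of the edges of $G$ and obtains a graph $H$ on the same vertex set such that 1. $H$ has at most $2\sqrt{\gamma}$ connected components, and 2. the geometric dual $H^*$ of $H$ satisfies $\operatorname{girth}(H^*)\ge \dfrac{k}{3\sqrt{\gamma}}$. Moreover, $H$ arises from $G$ by successively deleting the edges that correspond to a cycle of length less than $\frac{k}{3\sqrt\gamma}$ in the dual of the current graph. Here each graph $G'$ obtained from $G$ by deleting edges, in particular $H$, carries the induced rotation system, which embeds each of its connected components cellularly in a closed orientable surface of its own; the dual of $G'$ has the faces of these embeddings as its vertices, and each edge of $G'$ gives an edge of the dual that joins the faces on its two sides. The girth of a multigraph is the length of its shortest cycle (a loop has length $1$, a pair of parallel edges length $2$), and $\infty$ if there is no cycle. The running time is the number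 of steps of a random access machine with addition and truncated subtraction, bounded by a polynomial (independent of $k$ and $\gamma$) in $|V(G)|+|E(G)|$ plus the binary lengths of $k$ and $\gamma$. -/

import Mathlib

open scoped ENNReal

/-! ### Connectivity, components, cycles and girth of multigraphs -/

namespace Graph

variable {α β : Type*}

/-- The graph is nonempty and any two of its vertices are joined by a walk. -/
def Connected (G : Graph α β) : Prop :=
  G.vertexSet.Nonempty ∧
    ∀ x ∈ G.vertexSet, ∀ y ∈ G.vertexSet, Relation.ReflTransGen G.Adj x y

/-- `G` remains connected after the deletion of any set of fewer than `k` edges. -/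
def EdgeConnected (G : Graph α β) (k : ℕ) : Prop :=
  ∀ F : Finset β, F.card < k → (G.deleteEdges (F : Set β)).Connected

/-- The number of connected components. -/
noncomputable def numComponents (G : Graph α β) : ℕ :=
  Nat.card (Quot fun x y : G.vertexSet => G.Adj x y)

/-- `v 0, e 0, v 1, e 1, …, v (ℓ - 1), e (ℓ - 1), v 0` is a cycle of length `ℓ`: the vertices are
distinct, the edges are distinct, and `e i` joins `v i` to the cyclically next vertex. A loop is a
cycle of length `1`, a pair of parallel edges is a cycle of length `2`. -/
structure IsCycle (G : Graph α β) {ℓ : ℕ} (v : Fin ℓ → α) (e : Fin ℓ → β) : Prop where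
  pos : 0 < ℓ
  vertex_injective : Function.Injective v
  edge_injective : Function.Injective e
  isLink : ∀ i, G.IsLink (e i) (v i) (v (finRotate ℓ i))

/-- The length of a shortest cycle; it is `⊤` if there is no cycle. -/
noncomputable def girth (G : Graph α β) : ℕ∞ :=
  ⨅ (ℓ : ℕ) (v : Fin ℓ → α) (e : Fin ℓ → β) (_ : G.IsCycle v e), (ℓ : ℕ∞)

end Graph

/-! ### The permutation induced on a subset -/

section FirstReturn

variable {α β : Type*} [Finite β]

theorem exists_return (σ : Equiv.Perm β) (ι : α ↪ β) (a : α) :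
    ∃ i : ℕ, 0 < i ∧ ∃ a' : α, (σ ^ i) (ι a) = ι a' :=
  ⟨orderOf σ, orderOf_pos σ, a, by simp [pow_orderOf_eq_one]⟩

open Classical in
/-- The least `i > 0` such that `σ ^ i` takes `ι a` back into the range of `ι`. -/
noncomputable def returnTime (σ : Equiv.Perm β) (ι : α ↪ β) (a : α) : ℕ :=
  Nat.find (exists_return σ ι a)

theorem returnTime_spec (σ : Equiv.Perm β) (ι : α ↪ β) (a : α) :
    0 < returnTime σ ι a ∧ ∃ a' : α, (σ ^ returnTime σ ι a) (ι a) = ι a' := by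
  classical
  exact Nat.find_spec (exists_return σ ι a)

/-- The first point of the range of `ι` that follows `ι a` on its `σ`-orbit. -/
noncomputable def returnFun (σ : Equiv.Perm β) (ι : α ↪ β) (a : α) : α :=
  (returnTime_spec σ ι a).2.choose

theorem returnTime_pos (σ : Equiv.Perm β) (ι : α ↪ β) (a : α) : 0 < returnTime σ ι a :=
  (returnTime_spec σ ι a).1

theorem returnTime_le (σ : Equiv.Perm β) (ι : α ↪ β) {a a' : α} {i : ℕ} (hi : 0 < i)
    (h : (σ ^ i) (ι a) = ι a') : returnTime σ ι a ≤ i := by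
  classical
  exact Nat.find_min' (exists_return σ ι a) ⟨hi, a', h⟩

theorem pow_returnTime (σ : Equiv.Perm β) (ι : α ↪ β) (a : α) :
    (σ ^ returnTime σ ι a) (ι a) = ι (returnFun σ ι a) :=
  (returnTime_spec σ ι a).2.choose_spec

theorem returnFun_injective (σ : Equiv.Perm β) (ι : α ↪ β) :
    Function.Injective (returnFun σ ι) := by
  have key : ∀ a b : α, returnFun σ ι a = returnFun σ ι b →
      returnTime σ ι a ≤ returnTime σ ι b → a = b := by
    intro a b h hle
    have ha := pow_returnTime σ ι a
    have hb := pow_returnTime σ ι b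
    obtain ⟨d, hd⟩ := Nat.exists_eq_add_of_le hle
    have h1 : (σ ^ d) (ι b) = ι a := by
      apply (σ ^ returnTime σ ι a).injective
      rw [ha, h, ← hb, hd, pow_add, Equiv.Perm.mul_apply]
    rcases Nat.eq_zero_or_pos d with h0 | h0
    · subst h0
      exact (ι.injective (by simpa using h1)).symm
    · have h2 := returnTime_le σ ι h0 h1
      have h3 := returnTime_pos σ ι a
      omega
  intro a b h
  rcases le_total (returnTime σ ι a) (returnTime σ ι b) with hle | hle
  · exact key a b h hle
  · exact (key b a h.symm hle).symm

/-- The permutation that `σ` induces on a subset (given by the embedding `ι`): each cycle of `σ`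
is shortened by leaving out the points outside of the subset. -/
noncomputable def inducedPerm (σ : Equiv.Perm β) (ι : α ↪ β) : Equiv.Perm α :=
  haveI : Finite α := Finite.of_injective ι ι.injective
  Equiv.ofBijective (returnFun σ ι) (Finite.injective_iff_bijective.1 (returnFun_injective σ ι))

theorem inducedPerm_apply (σ : Equiv.Perm β) (ι : α ↪ β) (a : α) :
    inducedPerm σ ι a = returnFun σ ι a := rfl

theorem inducedPerm_sameCycle_iff (σ : Equiv.Perm β) (ι : α ↪ β) (a b : α) :
    (inducedPerm σ ι).SameCycle a b ↔ σ.SameCycle (ι a) (ι b) := by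
  have : Finite α := Finite.of_injective ι ι.injective
  constructor
  · intro h
    obtain ⟨i, rfl⟩ := h.exists_nat_pow_eq
    clear h
    induction i with
    | zero => exact Equiv.Perm.SameCycle.refl _ _
    | succ i ih =>
      rw [pow_succ', Equiv.Perm.mul_apply, inducedPerm_apply, ← pow_returnTime]
      exact ih.trans (Equiv.Perm.sameCycle_pow_right.2 (Equiv.Perm.SameCycle.refl _ _))
  · intro h
    obtain ⟨i, hi⟩ := h.exists_nat_pow_eq
    clear h
    induction i using Nat.strong_induction_on generalizing a with
    | _ i ih =>
      rcases Nat.eq_zero_or_pos i with h0 | h0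
      · subst h0
        have : a = b := ι.injective (by simpa using hi)
        exact this ▸ Equiv.Perm.SameCycle.refl _ _
      · have hle := returnTime_le σ ι h0 hi
        have hpos := returnTime_pos σ ι a
        have h1 : (σ ^ (i - returnTime σ ι a)) (ι (returnFun σ ι a)) = ι b := by
          rw [← pow_returnTime, ← Equiv.Perm.mul_apply, ← pow_add, Nat.sub_add_cancel hle, hi]
        have h2 := ih _ (by omega) _ h1
        rw [← inducedPerm_apply] at h2
        exact Equiv.Perm.sameCycle_apply_left.1 h2

end FirstReturn

/-! ### Graphs embedded on orientable surfaces -/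

/-- A finite multigraph with vertex set `V` and edge set `E`, cellularly embedded on oriented closed
surfaces (one surface for each connected component), given by its rotation system. Every edge `e`
has two darts (directed edges) `(e, false)` and `(e, true)`, each the reverse of the other.
`tail d` is the vertex at which `d` starts, and `rot d` is the dart that follows `d` in the cyclic
order, given by the orientation of the surface, of the darts that start at that vertex.
Vertices without darts are isolated vertices. -/
structure EmbeddedGraph (V E : Type*) where
  tail : E × Bool → V
  rot : Equiv.Perm (E × Bool)
  tail_eq_iff : ∀ d d', tail d = tail d' ↔ rot.SameCycle d d'

namespace EmbeddedGraph

variable {V E : Type*}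

/-- Reversal of darts. -/
def rev : Equiv.Perm (E × Bool) where
  toFun d := (d.1, !d.2)
  invFun d := (d.1, !d.2)
  left_inv d := by simp
  right_inv d := by simp

/-- The underlying multigraph. -/
def graph (M : EmbeddedGraph V E) : Graph V E where
  vertexSet := Set.univ
  IsLink e x y := ∃ b : Bool, M.tail (e, b) = x ∧ M.tail (e, !b) = y
  isLink_symm e _ := ⟨fun x y ⟨b, h1, h2⟩ => ⟨!b, h2, by simpa using h1⟩⟩
  eq_or_eq_of_isLink_of_isLink := by
    rintro e x y v w ⟨b, rfl, rfl⟩ ⟨c, rfl, rfl⟩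
    cases b <;> cases c <;> simp
  left_mem_of_isLink := by simp

/-- Walking along the boundary of a face: traverse `d`, then take the next dart in the rotation at
the head of `d`. -/
def faceStep (M : EmbeddedGraph V E) : Equiv.Perm (E × Bool) := rev.trans M.rot

/-- The faces. A face that is incident with an edge is a cycle of `faceStep` (the darts that have
the face on one fixed side); each isolated vertex lies on a sphere of its own, which
contributes one further face, incident with no edge. -/
def Face (M : EmbeddedGraph V E) : Type _ :=
  Quotient (Equiv.Perm.SameCycle.setoid M.faceStep) ⊕ {x : V // ∀ d, M.tail d ≠ x}

/-- The face on the (fixed) side of a dart. -/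
def faceOf (M : EmbeddedGraph V E) (d : E × Bool) : M.Face :=
  Sum.inl (Quotient.mk (Equiv.Perm.SameCycle.setoid M.faceStep) d)

/-- The geometric dual: its vertices are the faces, and the edge of the dual that corresponds to
`e` (and is called `e` again) joins the faces on the two sides of `e`. -/
def dual (M : EmbeddedGraph V E) : Graph M.Face E where
  vertexSet := Set.univ
  IsLink e f g := ∃ b : Bool, M.faceOf (e, b) = f ∧ M.faceOf (e, !b) = g
  isLink_symm e _ := ⟨fun x y ⟨b, h1, h2⟩ => ⟨!b, h2, by simpa using h1⟩⟩
  eq_or_eq_of_isLink_of_isLink := by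
    rintro e x y v w ⟨b, rfl, rfl⟩ ⟨c, rfl, rfl⟩
    cases b <;> cases c <;> simp
  left_mem_of_isLink := by simp

/-- The Euler characteristic `|V| - |E| + |F|`. For a connected graph this is the Euler
characteristic `2 - 2 g` of the closed orientable surface, of genus `g`, on which it is cellularly
embedded. -/
noncomputable def eulerChar (M : EmbeddedGraph V E) : ℤ :=
  Nat.card V - Nat.card E + Nat.card M.Face

/-- The inclusion of the darts of the edges in `S` into all the darts. -/
def dartEmbedding (S : Set E) : S × Bool ↪ E × Bool :=
  ⟨fun d => (d.1, d.2), fun d d' h => by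
    have h1 := congrArg Prod.fst h
    have h2 := congrArg Prod.snd h
    exact Prod.ext (Subtype.ext h1) h2⟩

/-- The embedded graph that is left after the deletion of all edges outside of `S`. All the
vertices are kept, and the cyclic orders at the vertices are the induced ones. -/
noncomputable def keep [Finite E] (M : EmbeddedGraph V E) (S : Set E) : EmbeddedGraph V S where
  tail d := M.tail (dartEmbedding S d)
  rot := inducedPerm M.rot (dartEmbedding S)
  tail_eq_iff d d' := by rw [inducedPerm_sameCycle_iff, M.tail_eq_iff]

/-- `M.CycleDeletion L S`: starting from `M`, one can arrive at the graph with edge set `S` by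
deleting, repeatedly, the edges that correspond to a cycle of length less than `L` in the dual of
the current embedded graph. -/
inductive CycleDeletion [Finite E] (M : EmbeddedGraph V E) (L : ℝ) : Set E → Prop
  | start : CycleDeletion M L Set.univ
  | delete (S : Set E) (ℓ : ℕ) (v : Fin ℓ → (M.keep S).Face) (e : Fin ℓ → S) :
      CycleDeletion M L S → (M.keep S).dual.IsCycle v e → (ℓ : ℝ) < L →
      CycleDeletion M L (S \ Set.range fun i => (e i : E))

end EmbeddedGraph

/-! ### A machine model with a step count

Structured programs for a random access machine whose memory consists of finitely many (those named
in the program) infinite arrays of natural numbers, with indirect addressing. The only arithmetic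
operations are addition and truncated subtraction, and every operation costs one step. As the length
of the numbers grows by at most one bit per operation, polynomial time on this machine is polynomial
time on a Turing machine. -/

namespace RAM

/-- `μ a i` is the content of cell `i` of array `a`. -/
abbrev Store : Type := ℕ → ℕ → ℕ

inductive Expr : Type
  | const (c : ℕ)
  | read (a : ℕ) (i : Expr)
  | add (x y : Expr)
  | sub (x y : Expr)

/-- The value of an expression. -/
def Expr.eval (μ : Store) : Expr → ℕ
  | const c => c
  | read a i => μ a (i.eval μ)
  | add x y => x.eval μ + y.eval μ
  | sub x y => x.eval μ - y.eval μ

/-- The number of steps for the evaluation of an expression. -/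
def Expr.cost : Expr → ℕ
  | const _ => 1
  | read _ i => 1 + i.cost
  | add x y => 1 + x.cost + y.cost
  | sub x y => 1 + x.cost + y.cost

inductive Prog : Type
  | nop
  | write (a : ℕ) (i x : Expr)
  | seq (P Q : Prog)
  | ite (c : Expr) (P Q : Prog)
  | loop (c : Expr) (P : Prog)

/-- The store after writing `x` into cell `i` of array `a`. -/
def Store.set (μ : Store) (a i x : ℕ) : Store :=
  fun a' i' => if a' = a ∧ i' = i then x else μ a' i'

/-- `Exec P μ μ' t`: the program `P`, started on the store `μ`, halts after `t` steps with the
store `μ'`. In a test, nonzero means true; `loop c P` is `while c do P`. -/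
inductive Exec : Prog → Store → Store → ℕ → Prop
  | nop (μ : Store) : Exec .nop μ μ 1
  | write (μ : Store) (a : ℕ) (i x : Expr) :
      Exec (.write a i x) μ (μ.set a (i.eval μ) (x.eval μ)) (1 + i.cost + x.cost)
  | seq {P Q : Prog} {μ₀ μ₁ μ₂ : Store} {s t : ℕ} :
      Exec P μ₀ μ₁ s → Exec Q μ₁ μ₂ t → Exec (.seq P Q) μ₀ μ₂ (s + t)
  | ite_true {c : Expr} {P : Prog} (Q : Prog) {μ μ' : Store} {t : ℕ} :
      c.eval μ ≠ 0 → Exec P μ μ' t → Exec (.ite c P Q) μ μ' (1 + c.cost + t)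
  | ite_false {c : Expr} (P : Prog) {Q : Prog} {μ μ' : Store} {t : ℕ} :
      c.eval μ = 0 → Exec Q μ μ' t → Exec (.ite c P Q) μ μ' (1 + c.cost + t)
  | loop_done {c : Expr} (P : Prog) {μ : Store} :
      c.eval μ = 0 → Exec (.loop c P) μ μ (1 + c.cost)
  | loop_step {c : Expr} {P : Prog} {μ₀ μ₁ μ₂ : Store} {s t : ℕ} :
      c.eval μ₀ ≠ 0 → Exec P μ₀ μ₁ s → Exec (.loop c P) μ₁ μ₂ t →
      Exec (.loop c P) μ₀ μ₂ (1 + c.cost + s + t)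

/-- The dart `(e, b)` has the number `2 e` or `2 e + 1`. -/
def dartCode {m : ℕ} (d : Fin m × Bool) : ℕ := 2 * d.1 + d.2.toNat

/-- The dart with number `i`. -/
def dartOfCode {m : ℕ} (i : ℕ) (h : i < 2 * m) : Fin m × Bool :=
  (⟨i / 2, by omega⟩, i % 2 == 1)

/-- The input: array `0` holds the number `n` of vertices, the number `m` of edges, `k` and `γ`;
arrays `1` and `2` tabulate the functions `tail` and `rot` of the embedded graph.
All other cells are zero. -/
def input {n m : ℕ} (M : EmbeddedGraph (Fin n) (Fin m)) (k γ : ℕ) : Store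
  | 0, 0 => n
  | 0, 1 => m
  | 0, 2 => k
  | 0, 3 => γ
  | 1, i => if h : i < 2 * m then (M.tail (dartOfCode i h) : ℕ) else 0
  | 2, i => if h : i < 2 * m then dartCode (M.rot (dartOfCode i h)) else 0
  | _, _ => 0

/-- The length of the input: the number of vertices and edges plus the binary lengths of the two
numerical parameters. -/
def inputSize (n m k γ : ℕ) : ℕ := n + m + Nat.size k + Nat.size γ

/-- The output: array `3` marks (by a nonzero entry) the edges to be deleted; this is the set of the
edges that are kept. -/
def keptEdges (m : ℕ) (μ : Store) : Set (Fin m) := {e | μ 3 e = 0}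

end RAM

/-! The algorithm is greedy: as long as the dual of the current graph has a cycle shorter than L =
k/(3√γ), its edges are deleted. At the end the girth bound holds by construction; the bound on the
number c of components of H needs an argument.

Suppose that t cycles with D edges in all have been deleted, so D ≤ tL. If c ≥ 2, at least k edges
of G leave each component of H; all of them have been deleted, and a deleted edge counts for at most
two components, so ck ≤ 2D (`conn_mul_le`). On the other hand, deleting the edges of a dual cycle
raises |V| - |E| + |F| by at least 2 (`numCycles_le_of_isCycle`), while this number never exceeds
twice the number of components (`euler_le`). As it is at least 2 - 2γ in the beginning, t + 1 ≤ c +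
γ. With s = √γ both estimates give 3sc ≤ 2t ≤ 2(c + s² - 1), which is impossible for c > 2s.

The topology is done with permutations. The faces after a deletion are read off from `walkPerm`, a
permutation of all the original darts that skips the deleted ones. Deleting an edge multiplies it by
the transposition of the two darts of that edge (`walkPerm_diff`), which merges two cycles or splits
one.

For the algorithm, a shortest dual cycle through an edge e is e together with a shortest path in the
dual, avoiding e, between the two sides of e; breadth-first search finds it. The condition ℓ < L is
tested as 9γℓ² < k², with additions only. Every deletion removes an edge, so polynomially many
searches suffice. -/

/-! ### Cycles of permutations -/

section PermCycles

variable {α : Type*}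

/-- The number of cycles, fixed points included. -/
noncomputable def numCycles (σ : Equiv.Perm α) : ℕ :=
  Nat.card (Quotient (Equiv.Perm.SameCycle.setoid σ))

/-- Joining two classes of an equivalence relation lowers the number of classes by one. -/
theorem card_quotient_merge [Finite α] (r s : Setoid α) (a b : α) (hab : ¬ r a b) (hrs : r ≤ s)
    (hs : s a b) (h : ∀ x y, s x y → r x y ∨ (r x a ∧ r y b) ∨ (r x b ∧ r y a)) :
    Nat.card (Quotient s) + 1 = Nat.card (Quotient r) := by
  classical
  have := Fintype.ofFinite α
  -- The class of `a` can be left out, since its `s`-class is also represented by `b`.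
  let f : {q : Quotient r // q ≠ Quotient.mk r a} → Quotient s :=
    fun q => Quotient.map' (s₁ := r) (s₂ := s) id hrs q.1
  have hf : Function.Bijective f := by
    constructor
    · rintro ⟨p, hp⟩ ⟨q, hq⟩ hpq
      induction p using Quotient.inductionOn with | _ x
      induction q using Quotient.inductionOn with | _ y
      have hx : ¬ r x a := fun h => hp (Quotient.sound h)
      have hy : ¬ r y a := fun h => hq (Quotient.sound h)
      have hxy : s x y := Quotient.exact hpq
      rcases h x y hxy with h | h | h
      · exact Subtype.ext (Quotient.sound h)
      · exact absurd h.1 hx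
      · exact absurd h.2 hy
    · intro q
      induction q using Quotient.inductionOn with | _ x
      by_cases hx : r x a
      · refine ⟨⟨Quotient.mk r b, fun h => hab (r.symm (Quotient.exact h))⟩, ?_⟩
        exact Quotient.sound (s.symm (s.trans (hrs hx) hs))
      · exact ⟨⟨Quotient.mk r x, fun h => hx (Quotient.exact h)⟩, rfl⟩
  rw [← Nat.card_congr (Equiv.ofBijective f hf)]
  have := Fintype.ofFinite (Quotient r)
  rw [Nat.card_eq_fintype_card, Nat.card_eq_fintype_card, Fintype.card_subtype_compl,
    Fintype.card_subtype_eq]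
  have : 0 < Fintype.card (Quotient r) := Fintype.card_pos_iff.2 ⟨Quotient.mk r a⟩
  omega

theorem sameCycle_mem_of_mapsTo [Finite α] {σ : Equiv.Perm α} {X : Set α}
    (hX : ∀ x ∈ X, σ x ∈ X) {x y : α} (hx : x ∈ X) (h : σ.SameCycle x y) : y ∈ X := by
  obtain ⟨i, rfl⟩ := h.exists_nat_pow_eq
  clear h
  induction i with
  | zero => exact hx
  | succ i ih => rw [pow_succ', Equiv.Perm.mul_apply]; exact hX _ ih

/-- A relation that contains every step of a permutation contains its cycles. -/
theorem sameCycle_le [Finite α] {σ : Equiv.Perm α} (r : Setoid α) (h : ∀ x, r x (σ x)) {x y : α}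
    (hxy : σ.SameCycle x y) : r x y :=
  sameCycle_mem_of_mapsTo (X := {z | r x z}) (fun z hz => r.trans hz (h z)) (r.refl x) hxy

theorem exists_minimal_period [Finite α] (σ : Equiv.Perm α) (a : α) :
    ∃ p, 0 < p ∧ (σ ^ p) a = a ∧ ∀ i, 0 < i → i < p → (σ ^ i) a ≠ a := by
  classical
  have h : ∃ p, 0 < p ∧ (σ ^ p) a = a := ⟨orderOf σ, orderOf_pos σ, by simp [pow_orderOf_eq_one]⟩
  refine ⟨Nat.find h, (Nat.find_spec h).1, (Nat.find_spec h).2, fun i hi hlt he => ?_⟩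
  exact Nat.find_min h hlt ⟨hi, he⟩

variable [DecidableEq α] {σ : Equiv.Perm α} {a b : α}

theorem mul_swap_apply_left : (σ * Equiv.swap a b) a = σ b := by simp

theorem mul_swap_apply_right : (σ * Equiv.swap a b) b = σ a := by simp

theorem mul_swap_apply_of_ne {x : α} (ha : x ≠ a) (hb : x ≠ b) :
    (σ * Equiv.swap a b) x = σ x := by
  simp [Equiv.swap_apply_of_ne_of_ne ha hb]

variable [Finite α]

/-- From `b` the new permutation jumps to `σ a` and then follows the old cycle of `a`, undisturbed
until it arrives at `a`. -/
theorem sameCycle_mul_swap (h : ¬ σ.SameCycle a b) : (σ * Equiv.swap a b).SameCycle a b := by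
  obtain ⟨p, hp, hpa, hmin⟩ := exists_minimal_period σ a
  have key : ∀ i, 0 < i → i ≤ p → ((σ * Equiv.swap a b) ^ i) b = (σ ^ i) a := by
    intro i
    induction i with
    | zero => intro h; omega
    | succ i ih =>
      intro _ hi
      rcases Nat.eq_zero_or_pos i with rfl | h0
      · simp
      · have hb : (σ ^ i) a ≠ b := fun hb => h ⟨i, by simpa using hb⟩
        rw [pow_succ', Equiv.Perm.mul_apply, ih h0 (by omega), pow_succ' σ,
          mul_swap_apply_of_ne (hmin i h0 (by omega)) hb, Equiv.Perm.mul_apply]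
  exact Equiv.Perm.SameCycle.symm ⟨p, by rw [zpow_natCast, key p hp le_rfl, hpa]⟩

/-- Let `q` be the first time at which the orbit of `a` meets `b`. The points `σ a`, …, `σ ^ q a =
b` are closed under the new permutation, because `b` is now sent to `σ a`; and `a` is not among
them. -/
theorem not_sameCycle_mul_swap (hab : a ≠ b) (h : σ.SameCycle a b) :
    ¬ (σ * Equiv.swap a b).SameCycle a b := by
  obtain ⟨p, hp, hpa, hmin⟩ := exists_minimal_period σ a
  have hex : ∃ q, (σ ^ q) a = b := h.exists_nat_pow_eq
  set q := Nat.find hex with hqdef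
  have hqb : (σ ^ q) a = b := Nat.find_spec hex
  have hqmin : ∀ i < q, (σ ^ i) a ≠ b := fun i hi => Nat.find_min hex hi
  have hq0 : 0 < q := Nat.pos_of_ne_zero fun h0 => hab (by rw [h0] at hqb; simpa using hqb)
  have hqp : q < p := by
    by_contra hle
    refine hqmin (q - p) (by omega) ?_
    have : (σ ^ (q - p)) ((σ ^ p) a) = b := by
      rw [← Equiv.Perm.mul_apply, ← pow_add, Nat.sub_add_cancel (by omega), hqb]
    rwa [hpa] at this
  intro hs
  have := sameCycle_mem_of_mapsTo (σ := σ * Equiv.swap a b)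
    (X := {x | ∃ i, 0 < i ∧ i ≤ q ∧ (σ ^ i) a = x}) ?_ ⟨q, hq0, le_rfl, hqb⟩ hs.symm
  · obtain ⟨i, hi, hiq, hia⟩ := this
    exact hmin i hi (by omega) hia
  · rintro x ⟨i, hi, hiq, rfl⟩
    rcases hiq.lt_or_eq with hlt | rfl
    · refine ⟨i + 1, by omega, hlt, ?_⟩
      rw [mul_swap_apply_of_ne (hmin i hi (by omega)) (hqmin i hlt), pow_succ',
        Equiv.Perm.mul_apply]
    · exact ⟨1, one_pos, hi, by rw [hqb, mul_swap_apply_right, pow_one]⟩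

/-- Only the steps at `a` and `b` change, and both can be bridged inside the joined cycle. -/
theorem SameCycle.mul_swap (h : ¬ σ.SameCycle a b) {x y : α} (hxy : σ.SameCycle x y) :
    (σ * Equiv.swap a b).SameCycle x y := by
  refine sameCycle_le (Equiv.Perm.SameCycle.setoid (σ * Equiv.swap a b)) (fun z => ?_) hxy
  change (σ * Equiv.swap a b).SameCycle z (σ z)
  have hab := sameCycle_mul_swap h
  by_cases ha : z = a
  · subst ha
    rw [← mul_swap_apply_right (a := z) (b := b)]
    exact hab.trans (Equiv.Perm.sameCycle_apply_right.2 (Equiv.Perm.SameCycle.refl _ _))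
  · by_cases hb : z = b
    · subst hb
      rw [← mul_swap_apply_left (a := a) (b := z)]
      exact hab.symm.trans (Equiv.Perm.sameCycle_apply_right.2 (Equiv.Perm.SameCycle.refl _ _))
    · rw [← mul_swap_apply_of_ne ha hb]
      exact Equiv.Perm.sameCycle_apply_right.2 (Equiv.Perm.SameCycle.refl _ _)

theorem numCycles_mul_swap_of_not_sameCycle (h : ¬ σ.SameCycle a b) :
    numCycles (σ * Equiv.swap a b) + 1 = numCycles σ := by
  refine card_quotient_merge (Equiv.Perm.SameCycle.setoid σ)
    (Equiv.Perm.SameCycle.setoid (σ * Equiv.swap a b)) a b h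
    (fun {x y} hxy => SameCycle.mul_swap h hxy) (sameCycle_mul_swap h) ?_
  have hσ : ∀ z, σ.SameCycle z (σ z) := fun z =>
    Equiv.Perm.sameCycle_apply_right.2 (Equiv.Perm.SameCycle.refl _ _)
  intro x y hxy
  change σ.SameCycle x y ∨ (σ.SameCycle x a ∧ σ.SameCycle y b) ∨ (σ.SameCycle x b ∧ σ.SameCycle y a)
  refine sameCycle_mem_of_mapsTo (X := {y | σ.SameCycle x y ∨
    (σ.SameCycle x a ∧ σ.SameCycle y b) ∨ (σ.SameCycle x b ∧ σ.SameCycle y a)}) ?_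
    (Or.inl (Equiv.Perm.SameCycle.refl _ _)) hxy
  intro z hz
  change σ.SameCycle x _ ∨ (σ.SameCycle x a ∧ σ.SameCycle _ b) ∨ (σ.SameCycle x b ∧ σ.SameCycle _ a)
  by_cases ha : z = a
  · subst ha
    rw [mul_swap_apply_left]
    rcases hz with hz | hz | hz
    · exact Or.inr (Or.inl ⟨hz, (hσ b).symm⟩)
    · exact absurd hz.2 h
    · exact Or.inl (hz.1.trans (hσ b))
  · by_cases hb : z = b
    · subst hb
      rw [mul_swap_apply_right]
      rcases hz with hz | hz | hz
      · exact Or.inr (Or.inr ⟨hz, (hσ a).symm⟩)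
      · exact Or.inl (hz.1.trans (hσ a))
      · exact absurd hz.2.symm h
    · rw [mul_swap_apply_of_ne ha hb, Equiv.Perm.sameCycle_apply_right,
        Equiv.Perm.sameCycle_apply_left, Equiv.Perm.sameCycle_apply_left]
      exact hz

/-- A transposition is an involution, so a split is a merge read backwards. -/
theorem numCycles_mul_swap_of_sameCycle (hab : a ≠ b) (h : σ.SameCycle a b) :
    numCycles (σ * Equiv.swap a b) = numCycles σ + 1 := by
  have := numCycles_mul_swap_of_not_sameCycle (not_sameCycle_mul_swap hab h)
  rw [mul_assoc, Equiv.swap_mul_self, mul_one] at this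
  exact this.symm

theorem numCycles_le_mul_swap_add_one (hab : a ≠ b) :
    numCycles σ ≤ numCycles (σ * Equiv.swap a b) + 1 := by
  by_cases h : σ.SameCycle a b
  · have := numCycles_mul_swap_of_sameCycle hab h; omega
  · exact (numCycles_mul_swap_of_not_sameCycle h).ge

end PermCycles

/-! ### Faces after deletions, as cycles of permutations of all darts -/

namespace EmbeddedGraph

variable {V E : Type*}

theorem rev_rev (d : E × Bool) : rev (rev d) = d := by simp [rev]

theorem rev_fst (d : E × Bool) : (rev d).1 = d.1 := rfl

theorem rev_ne (d : E × Bool) : rev d ≠ d := fun h => by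
  have := congrArg Prod.snd h
  simp [rev] at this

theorem eq_or_eq_rev {d d' : E × Bool} (h : d.1 = d'.1) : d = d' ∨ d = rev d' := by
  obtain ⟨e, b⟩ := d
  obtain ⟨e', b'⟩ := d'
  obtain rfl : e = e' := h
  cases b <;> cases b' <;> simp [rev]

open Classical in
/-- Reversal of the darts of the edges in `S`. -/
noncomputable def flipOn (S : Set E) : Equiv.Perm (E × Bool) :=
  Function.Involutive.toPerm (fun d => if d.1 ∈ S then rev d else d) fun d => by
    by_cases h : d.1 ∈ S <;> simp [h, rev_fst, rev_rev]

theorem flipOn_of_mem {S : Set E} {d : E × Bool} (h : d.1 ∈ S) : flipOn S d = rev d :=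
  if_pos h

theorem flipOn_of_notMem {S : Set E} {d : E × Bool} (h : d.1 ∉ S) : flipOn S d = d :=
  if_neg h

/-- The face walk of the graph that is left after the deletion of the edges outside of `S`,
extended to a permutation of all darts: the darts of deleted edges are skipped. -/
noncomputable def walkPerm (M : EmbeddedGraph V E) (S : Set E) : Equiv.Perm (E × Bool) :=
  M.rot * flipOn S

theorem walkPerm_of_mem (M : EmbeddedGraph V E) {S : Set E} {d : E × Bool} (h : d.1 ∈ S) :
    M.walkPerm S d = M.rot (rev d) := by
  rw [walkPerm, Equiv.Perm.mul_apply, flipOn_of_mem h]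

theorem walkPerm_of_notMem (M : EmbeddedGraph V E) {S : Set E} {d : E × Bool} (h : d.1 ∉ S) :
    M.walkPerm S d = M.rot d := by
  rw [walkPerm, Equiv.Perm.mul_apply, flipOn_of_notMem h]

theorem walkPerm_univ (M : EmbeddedGraph V E) : M.walkPerm Set.univ = M.faceStep := by
  ext1 d
  rw [M.walkPerm_of_mem (Set.mem_univ _)]
  rfl

theorem walkPerm_empty (M : EmbeddedGraph V E) : M.walkPerm ∅ = M.rot := by
  ext1 d
  rw [M.walkPerm_of_notMem (Set.notMem_empty _)]

/-- The identity behind all face counts: since a deletion is multiplication by a transposition, the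
number of cycles changes by exactly one, up or down according to whether the edge has the same face
on both sides. -/
theorem walkPerm_diff [DecidableEq E] (M : EmbeddedGraph V E) {S : Set E} {d : E × Bool}
    (h : d.1 ∈ S) : M.walkPerm (S \ {d.1}) = M.walkPerm S * Equiv.swap d (rev d) := by
  ext1 x
  by_cases hx : x.1 = d.1
  · rw [M.walkPerm_of_notMem (by simp [hx])]
    rcases eq_or_eq_rev hx with rfl | rfl
    · rw [mul_swap_apply_left, M.walkPerm_of_mem (by simpa [rev_fst] using h), rev_rev]
    · rw [mul_swap_apply_right, M.walkPerm_of_mem h]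
  · rw [mul_swap_apply_of_ne (fun h => hx (by rw [h])) (fun h => hx (by rw [h, rev_fst]))]
    by_cases hxS : x.1 ∈ S
    · have hxd : x.1 ∈ S \ {d.1} := ⟨hxS, by simpa using hx⟩
      rw [M.walkPerm_of_mem hxS, M.walkPerm_of_mem hxd]
    · rw [M.walkPerm_of_notMem hxS, M.walkPerm_of_notMem fun h => hxS h.1]

theorem walkPerm_insert [DecidableEq E] (M : EmbeddedGraph V E) {S : Set E} {d : E × Bool}
    (h : d.1 ∉ S) : M.walkPerm (insert d.1 S) = M.walkPerm S * Equiv.swap d (rev d) := by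
  have := M.walkPerm_diff (Set.mem_insert d.1 S)
  rw [Set.insert_sdiff_of_mem _ (Set.mem_singleton _), Set.sdiff_singleton_eq_self h] at this
  rw [this, mul_assoc, Equiv.swap_mul_self, mul_one]

theorem mem_of_dartEmbedding {S : Set E} (d : S × Bool) : (dartEmbedding S d).1 ∈ S := d.1.2

/-- From a kept dart `x`, `walkPerm` goes to `rot (rev x)` and then turns around the vertex until it
meets a kept dart. This is the first return of `rot` from `rev x`. -/
theorem keep_faceStep [Finite E] (M : EmbeddedGraph V E) (S : Set E) :
    (M.keep S).faceStep = inducedPerm (M.walkPerm S) (dartEmbedding S) := by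
  ext1 x
  set ι := dartEmbedding S
  change returnFun M.rot ι (rev x) = returnFun (M.walkPerm S) ι x
  have hpow : ∀ i, 0 < i → i ≤ returnTime M.rot ι (rev x) →
      (M.walkPerm S ^ i) (ι x) = (M.rot ^ i) (ι (rev x)) := by
    intro i
    induction i with
    | zero => intro h; omega
    | succ i ih =>
      intro _ hi
      rcases Nat.eq_zero_or_pos i with rfl | h0
      · rw [zero_add, pow_one, pow_one, M.walkPerm_of_mem (mem_of_dartEmbedding x)]
        rfl
      · rw [pow_succ', Equiv.Perm.mul_apply, ih h0 (by omega), pow_succ' M.rot,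
          Equiv.Perm.mul_apply, M.walkPerm_of_notMem]
        intro hmem
        have := returnTime_le M.rot ι (a := rev x)
          (a' := (⟨_, hmem⟩, ((M.rot ^ i) (ι (rev x))).2)) h0 rfl
        omega
  have hle : returnTime (M.walkPerm S) ι x ≤ returnTime M.rot ι (rev x) :=
    returnTime_le _ _ (returnTime_pos _ _ _)
      ((hpow _ (returnTime_pos _ _ _) le_rfl).trans (pow_returnTime _ _ _))
  have hw := pow_returnTime (M.walkPerm S) ι x
  rw [hpow _ (returnTime_pos _ _ _) hle] at hw
  have heq := le_antisymm hle (returnTime_le _ _ (returnTime_pos _ _ _) hw)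
  rw [heq, pow_returnTime] at hw
  exact ι.injective hw

theorem keep_faceOf_eq_iff [Finite E] (M : EmbeddedGraph V E) (S : Set E) (d d' : S × Bool) :
    (M.keep S).faceOf d = (M.keep S).faceOf d' ↔
      (M.walkPerm S).SameCycle (dartEmbedding S d) (dartEmbedding S d') := by
  rw [← inducedPerm_sameCycle_iff, ← keep_faceStep]
  constructor
  · intro h
    exact Quotient.exact (Sum.inl_injective h)
  · intro h
    exact congrArg Sum.inl (Quotient.sound h)

/-! ### Components -/

/-- Being joined by an edge of `S`. -/
def Joined (M : EmbeddedGraph V E) (S : Set E) (x y : V) : Prop :=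
  ∃ d : E × Bool, d.1 ∈ S ∧ M.tail d = x ∧ M.tail (rev d) = y

/-- The partition into the components of the graph with edge set `S`. -/
def conn (M : EmbeddedGraph V E) (S : Set E) : Setoid V := Relation.EqvGen.setoid (M.Joined S)

theorem Joined.conn {M : EmbeddedGraph V E} {S : Set E} {x y : V} (h : M.Joined S x y) :
    M.conn S x y := Relation.EqvGen.rel _ _ h

theorem conn_le {M : EmbeddedGraph V E} {S : Set E} (r : Setoid V)
    (h : ∀ x y, M.Joined S x y → r x y) : M.conn S ≤ r :=
  Setoid.eqvGen_le h

theorem keep_adj_iff [Finite E] (M : EmbeddedGraph V E) (S : Set E) (x y : V) :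
    (M.keep S).graph.Adj x y ↔ M.Joined S x y := by
  constructor
  · rintro ⟨e, b, hx, hy⟩
    exact ⟨(e, b), e.2, hx, hy⟩
  · rintro ⟨⟨e, b⟩, he, hx, hy⟩
    exact ⟨⟨e, he⟩, b, hx, hy⟩

/-- `Quot` by adjacency already passes to the generated equivalence relation, which is `conn`. -/
theorem numComponents_keep [Finite E] (M : EmbeddedGraph V E) (S : Set E) :
    (M.keep S).graph.numComponents = Nat.card (Quotient (M.conn S)) := by
  refine Nat.card_congr (Equiv.ofBijective (Quot.lift (fun x => Quotient.mk (M.conn S) x.1) ?_) ?_)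
  · intro x y h
    exact Quotient.sound ((M.keep_adj_iff S _ _).1 h).conn
  · constructor
    · intro p q
      induction p using Quot.ind with | _ x
      induction q using Quot.ind with | _ y
      intro h
      obtain ⟨x, hx⟩ := x
      obtain ⟨y, hy⟩ := y
      have h' : M.conn S x y := Quotient.exact h
      clear h
      induction h' with
      | rel x y h => exact Quot.sound ((M.keep_adj_iff S _ _).2 h)
      | refl x => rfl
      | symm x y _ ih => exact (ih hy hx).symm
      | trans x y z _ _ ih1 ih2 =>
        exact (ih1 hx (Set.mem_univ y)).trans (ih2 (Set.mem_univ y) hy)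
    · intro q
      induction q using Quotient.inductionOn with | _ x
      exact ⟨Quot.mk _ ⟨x, Set.mem_univ x⟩, rfl⟩

theorem conn_mono (M : EmbeddedGraph V E) {S T : Set E} (h : S ⊆ T) : M.conn S ≤ M.conn T :=
  conn_le _ fun _ _ ⟨d, hd, hx, hy⟩ => Joined.conn ⟨d, h hd, hx, hy⟩

theorem conn_insert (M : EmbeddedGraph V E) (S : Set E) (d : E × Bool) {x y : V}
    (h : M.conn (insert d.1 S) x y) : M.conn S x y ∨
      (M.conn S x (M.tail d) ∧ M.conn S y (M.tail (rev d))) ∨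
      (M.conn S x (M.tail (rev d)) ∧ M.conn S y (M.tail d)) := by
  have hs : ∀ {x y}, M.conn S x y → M.conn S y x := (M.conn S).symm
  have ht : ∀ {x y z}, M.conn S x y → M.conn S y z → M.conn S x z := (M.conn S).trans
  have hr : ∀ x, M.conn S x x := (M.conn S).refl
  induction h with
  | rel x y h =>
    obtain ⟨c, hc, rfl, rfl⟩ := h
    rcases hc with hc | hc
    · rcases eq_or_eq_rev hc with rfl | rfl
      · exact Or.inr (Or.inl ⟨hr _, hr _⟩)
      · exact Or.inr (Or.inr ⟨hr _, by rw [rev_rev]⟩)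
    · exact Or.inl (Joined.conn ⟨c, hc, rfl, rfl⟩)
  | refl x => exact Or.inl (hr x)
  | symm x y _ ih =>
    rcases ih with h | h | h
    · exact Or.inl (hs h)
    · exact Or.inr (Or.inr ⟨h.2, h.1⟩)
    · exact Or.inr (Or.inl ⟨h.2, h.1⟩)
  | trans x y z _ _ ih1 ih2 =>
    rcases ih1 with h | h | h <;> rcases ih2 with h' | h' | h'
    · exact Or.inl (ht h h')
    · exact Or.inr (Or.inl ⟨ht h h'.1, h'.2⟩)
    · exact Or.inr (Or.inr ⟨ht h h'.1, h'.2⟩)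
    · exact Or.inr (Or.inl ⟨h.1, ht (hs h') h.2⟩)
    · exact Or.inl (ht h.1 (ht (hs h'.1) (ht h.2 (hs h'.2))))
    · exact Or.inl (ht h.1 (hs h'.2))
    · exact Or.inr (Or.inr ⟨h.1, ht (hs h') h.2⟩)
    · exact Or.inl (ht h.1 (hs h'.2))
    · exact Or.inl (ht h.1 (ht (hs h'.1) (ht h.2 (hs h'.2))))

theorem tail_rot (M : EmbeddedGraph V E) (d : E × Bool) : M.tail (M.rot d) = M.tail d :=
  (M.tail_eq_iff _ _).2 (Equiv.Perm.sameCycle_apply_left.2 (Equiv.Perm.SameCycle.refl _ _))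

/-- Each step turns around a vertex, possibly after crossing a kept edge, so it stays in one
component. Hence an edge between two components has its darts on different cycles. -/
theorem conn_tail_of_sameCycle [Finite E] (M : EmbeddedGraph V E) {S : Set E} {d d' : E × Bool}
    (h : (M.walkPerm S).SameCycle d d') : M.conn S (M.tail d) (M.tail d') := by
  refine sameCycle_le ((M.conn S).comap M.tail) (fun x => ?_) h
  change M.conn S (M.tail x) (M.tail (M.walkPerm S x))
  by_cases hx : x.1 ∈ S
  · rw [M.walkPerm_of_mem hx, tail_rot]
    exact Joined.conn ⟨x, hx, rfl, rfl⟩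
  · rw [M.walkPerm_of_notMem hx, tail_rot]

/-- The Euler characteristic of the graph with edge set `S` is at most twice the number of its
components. The faces at vertices that become isolated by the deletion of edges are the cycles of
`walkPerm` without darts of edges in `S`. -/
theorem euler_le [Finite V] [Finite E] (M : EmbeddedGraph V E) (S : Set E) :
    Nat.card V + numCycles (M.walkPerm S) + Nat.card {x : V // ∀ d, M.tail d ≠ x} ≤
      2 * Nat.card (Quotient (M.conn S)) + S.ncard := by
  classical
  induction S, S.toFinite using Set.Finite.induction_on with
  | empty =>
    have h1 : Nat.card (Quotient (M.conn ∅)) = Nat.card V := by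
      refine Nat.card_congr (Equiv.ofBijective (Quotient.mk (M.conn ∅)) ⟨?_, ?_⟩).symm
      · intro x y h
        exact conn_le (M := M) (S := ∅) ⊥ (fun _ _ ⟨d, hd, _⟩ => absurd hd (Set.notMem_empty _))
          (Quotient.exact h)
      · exact Quotient.mk_surjective
    -- Without edges the cycles are those of `rot`, one for each vertex that carries a dart; with
    -- the isolated vertices there is one face per vertex, and equality holds.
    have h2 : numCycles (M.walkPerm ∅) = Nat.card {x : V // ¬ ∀ d, M.tail d ≠ x} := by
      rw [walkPerm_empty]
      refine Nat.card_congr (Equiv.ofBijective (Quotient.lift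
        (s := Equiv.Perm.SameCycle.setoid M.rot)
        (fun d => (⟨M.tail d, fun h => h d rfl⟩ : {x : V // ¬ ∀ d, M.tail d ≠ x})) ?_) ⟨?_, ?_⟩)
      · intro d d' h
        exact Subtype.ext ((M.tail_eq_iff d d').2 h)
      · intro p q
        induction p using Quotient.inductionOn with | _ x
        induction q using Quotient.inductionOn with | _ y
        intro h
        exact Quotient.sound ((M.tail_eq_iff x y).1 (Subtype.ext_iff.1 h))
      · rintro ⟨x, hx⟩
        push Not at hx
        obtain ⟨d, hd⟩ := hx
        exact ⟨Quotient.mk _ d, Subtype.ext hd⟩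
    have h3 : Nat.card {x : V // ∀ d, M.tail d ≠ x} + Nat.card {x : V // ¬ ∀ d, M.tail d ≠ x} =
        Nat.card V := by
      classical
      rw [← Nat.card_sum]
      exact Nat.card_congr (Equiv.sumCompl _)
    simp only [Set.ncard_empty]
    omega
  | @insert e S he _ ih =>
    have hd : ((e, false) : E × Bool).1 ∉ S := he
    rw [Set.ncard_insert_of_notMem he]
    change _ + numCycles (M.walkPerm (insert ((e, false) : E × Bool).1 S)) + _ ≤
      2 * Nat.card (Quotient (M.conn (insert ((e, false) : E × Bool).1 S))) + _
    generalize ((e, false) : E × Bool) = d at hd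
    rw [M.walkPerm_insert hd]
    by_cases h : M.conn S (M.tail d) (M.tail (rev d))
    · have hc : M.conn (insert d.1 S) = M.conn S := by
        refine le_antisymm (fun {x y} hxy => ?_) (M.conn_mono (Set.subset_insert _ _))
        rcases M.conn_insert S d hxy with h' | h' | h'
        · exact h'
        · exact (M.conn S).trans h'.1 ((M.conn S).trans h ((M.conn S).symm h'.2))
        · exact (M.conn S).trans h'.1
            ((M.conn S).trans ((M.conn S).symm h) ((M.conn S).symm h'.2))
      rw [hc]
      -- An edge inside a component: the right side grows by one, the left side by at most one.
      by_cases hs : (M.walkPerm S).SameCycle d (rev d)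
      · have := numCycles_mul_swap_of_sameCycle (rev_ne d).symm hs
        omega
      · have := numCycles_mul_swap_of_not_sameCycle hs
        omega
    -- An edge between two components: two components and two cycles merge, and both sides drop by
    -- one.
    · have := card_quotient_merge _ _ _ _ h (M.conn_mono (Set.subset_insert d.1 S))
        (Joined.conn ⟨d, Set.mem_insert _ _, rfl, rfl⟩) fun x y => M.conn_insert S d
      have := numCycles_mul_swap_of_not_sameCycle fun hs => h (M.conn_tail_of_sameCycle hs)
      omega

/-! ### The deletion of dual cycles -/

/-- The edges are deleted in order. Each deletion loses at most one cycle, so it is enough that one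
of them gains a cycle, which saves two. If the first `ℓ - 1` deletions are all merges, they gather
the darts of the walk on a single cycle; the last edge then has both of its darts there, and its
deletion splits the cycle. -/
theorem numCycles_le_of_closed_walk [Finite E] (M : EmbeddedGraph V E) (S : Set E)
    (d : ℕ → E × Bool) (ℓ : ℕ) (hℓ : 0 < ℓ) (hS : ∀ i < ℓ, (d i).1 ∈ S)
    (hinj : ∀ i < ℓ, ∀ j < ℓ, (d i).1 = (d j).1 → i = j)
    (hlink : ∀ i, i + 1 < ℓ → (M.walkPerm S).SameCycle (rev (d i)) (d (i + 1)))
    (hclose : (M.walkPerm S).SameCycle (rev (d (ℓ - 1))) (d 0)) :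
    numCycles (M.walkPerm S) + 2 ≤
      numCycles (M.walkPerm (S \ {e | ∃ i < ℓ, (d i).1 = e})) + ℓ := by
  classical
  set C : ℕ → Set E := fun j => S \ {e | ∃ i < j, (d i).1 = e} with hC
  have hsucc : ∀ j < ℓ, M.walkPerm (C (j + 1)) = M.walkPerm (C j) * Equiv.swap (d j) (rev (d j)) := by
    intro j hj
    rw [← M.walkPerm_diff]
    · congr 1
      ext e
      simp only [hC, Set.mem_sdiff, Set.mem_ofPred_eq, Set.mem_singleton_iff, not_exists, not_and]
      constructor
      · rintro ⟨h1, h2⟩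
        exact ⟨⟨h1, fun i hi => h2 i (by omega)⟩, fun h => h2 j (by omega) h.symm⟩
      · rintro ⟨⟨h1, h2⟩, h3⟩
        refine ⟨h1, fun i hi h => ?_⟩
        rcases Nat.lt_succ_iff_lt_or_eq.1 hi with hi | rfl
        · exact h2 i hi h
        · exact h3 h.symm
    · refine ⟨hS j hj, ?_⟩
      rintro ⟨i, hi, h⟩
      have := hinj i (by omega) j hj h
      omega
  -- Left: some deletion has already split a cycle. Right: all were merges, so old cycles stay
  -- together and each deleted edge has both darts on one cycle.
  have step : ∀ j ≤ ℓ, numCycles (M.walkPerm S) + 2 ≤ numCycles (M.walkPerm (C j)) + j ∨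
      (numCycles (M.walkPerm S) ≤ numCycles (M.walkPerm (C j)) + j ∧
        (∀ x y, (M.walkPerm S).SameCycle x y → (M.walkPerm (C j)).SameCycle x y) ∧
        ∀ i < j, (M.walkPerm (C j)).SameCycle (d i) (rev (d i))) := by
    intro j
    induction j with
    | zero =>
      intro _
      have h0 : C 0 = S := by simp [hC]
      exact Or.inr ⟨by rw [h0, add_zero], fun x y h => by rwa [h0], by simp⟩
    | succ j ih =>
      intro hj
      have hs := hsucc j (by omega)
      rcases ih (by omega) with h | ⟨h1, h2, h3⟩
      · left
        have := numCycles_le_mul_swap_add_one (σ := M.walkPerm (C j)) (rev_ne (d j)).symm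
        rw [hs]
        omega
      · by_cases hsame : (M.walkPerm (C j)).SameCycle (d j) (rev (d j))
        · left
          have := numCycles_mul_swap_of_sameCycle (rev_ne (d j)).symm hsame
          rw [hs]
          omega
        · right
          have := numCycles_mul_swap_of_not_sameCycle hsame
          refine ⟨by rw [hs]; omega, fun x y h => ?_, fun i hi => ?_⟩
          · rw [hs]
            exact SameCycle.mul_swap hsame (h2 x y h)
          · rw [hs]
            rcases Nat.lt_succ_iff_lt_or_eq.1 hi with hi | rfl
            · exact SameCycle.mul_swap hsame (h3 i hi)
            · exact sameCycle_mul_swap hsame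
  have hlast := hsucc (ℓ - 1) (by omega)
  rw [Nat.sub_add_cancel hℓ] at hlast
  change _ ≤ numCycles (M.walkPerm (C ℓ)) + ℓ
  rw [hlast]
  rcases step (ℓ - 1) (by omega) with h | ⟨h, hmono, hmerge⟩
  · have := numCycles_le_mul_swap_add_one (σ := M.walkPerm (C (ℓ - 1))) (rev_ne (d (ℓ - 1))).symm
    omega
  -- Merges connect `d i` with `rev (d i)`, and the walk connects `rev (d i)` with `d (i + 1)`.
  · have hchain : ∀ i, i < ℓ → (M.walkPerm (C (ℓ - 1))).SameCycle (d 0) (d i) := by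
      intro i
      induction i with
      | zero => exact fun _ => Equiv.Perm.SameCycle.refl _ _
      | succ i ih =>
        intro hi
        exact (ih (by omega)).trans ((hmerge i (by omega)).trans (hmono _ _ (hlink i hi)))
    have := numCycles_mul_swap_of_sameCycle (rev_ne (d (ℓ - 1))).symm
      ((hchain _ (by omega)).symm.trans (hmono _ _ hclose).symm)
    omega

/-- The darts of the edges of a dual cycle, directed such that consecutive ones meet in a face. -/
theorem exists_darts_of_isCycle [Finite E] (M : EmbeddedGraph V E) (S : Set E) {ℓ : ℕ}
    {v : Fin ℓ → (M.keep S).Face} {e : Fin ℓ → S} (h : (M.keep S).dual.IsCycle v e) :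
    ∃ d : Fin ℓ → E × Bool, (∀ i, (d i).1 = e i) ∧
      ∀ i, (M.walkPerm S).SameCycle (rev (d i)) (d (finRotate ℓ i)) := by
  choose b hb hb' using h.isLink
  refine ⟨fun i => dartEmbedding S (e i, b i), fun i => rfl, fun i => ?_⟩
  exact (M.keep_faceOf_eq_iff S (rev (e i, b i)) _).1 ((hb' i).trans (hb _).symm)

/-- As the cycle has `ℓ` edges and no vertex is lost, this says that |V| - |E| + |F| grows by at
least 2. The proof only passes from cyclic to natural indices. -/
theorem numCycles_le_of_isCycle [Finite E] (M : EmbeddedGraph V E) (S : Set E) {ℓ : ℕ}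
    {v : Fin ℓ → (M.keep S).Face} {e : Fin ℓ → S} (h : (M.keep S).dual.IsCycle v e) :
    numCycles (M.walkPerm S) + 2 ≤
      numCycles (M.walkPerm (S \ Set.range fun i => (e i : E))) + ℓ := by
  obtain ⟨d, hd, hlink⟩ := M.exists_darts_of_isCycle S h
  obtain ⟨N, rfl⟩ : ∃ N, ℓ = N + 1 := ⟨ℓ - 1, by have := h.pos; omega⟩
  have hofNat : ∀ i, ∀ h : i < N + 1, Fin.ofNat (N + 1) i = ⟨i, h⟩ := fun i h =>
    Fin.ext (Nat.mod_eq_of_lt h)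
  have hset : (Set.range fun i => (e i : E)) =
      {x | ∃ i < N + 1, (d (Fin.ofNat (N + 1) i)).1 = x} := by
    ext x
    constructor
    · rintro ⟨i, rfl⟩
      exact ⟨i, i.2, by rw [hofNat _ i.2, hd]⟩
    · rintro ⟨i, hi, rfl⟩
      exact ⟨⟨i, hi⟩, by rw [hofNat _ hi, hd]⟩
  rw [hset]
  refine M.numCycles_le_of_closed_walk S (fun i => d (Fin.ofNat (N + 1) i)) (N + 1) N.succ_pos
    (fun i _ => by rw [hd]; exact Subtype.coe_prop _) (fun i hi j hj hij => ?_) (fun i hi => ?_) ?_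
  · rw [hofNat _ hi, hofNat _ hj, hd, hd] at hij
    exact congrArg Fin.val (h.edge_injective (Subtype.ext hij))
  · have := hlink ⟨i, by omega⟩
    rw [finRotate_of_lt (by omega : i < N)] at this
    rwa [hofNat _ (by omega : i < N + 1), hofNat _ hi]
  · have := hlink ⟨N, by omega⟩
    rw [finRotate_last'] at this
    rw [Nat.add_sub_cancel, hofNat _ (by omega : N < N + 1), hofNat _ N.succ_pos]
    exact this

/-- Here `t` is the number of deleted cycles: each contributes fewer than `L` edges and a gain of 2
in the Euler characteristic. -/
theorem CycleDeletion.exists_count [Finite E] {M : EmbeddedGraph V E} {L : ℝ} {S : Set E}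
    (h : M.CycleDeletion L S) : ∃ t : ℕ, (Sᶜ.ncard : ℝ) ≤ t * L ∧
      numCycles M.faceStep + 2 * t ≤ numCycles (M.walkPerm S) + Sᶜ.ncard := by
  induction h with
  | start => exact ⟨0, by simp [walkPerm_univ]⟩
  | delete S ℓ v e _ hc hL ih =>
    obtain ⟨t, h1, h2⟩ := ih
    have hcard : (S \ Set.range fun i => (e i : E))ᶜ.ncard = Sᶜ.ncard + ℓ := by
      have hinj : Function.Injective fun i => (e i : E) :=
        Subtype.val_injective.comp hc.edge_injective
      have : (S \ Set.range fun i => (e i : E))ᶜ = Sᶜ ∪ Set.range fun i => (e i : E) := by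
        rw [Set.sdiff_eq, Set.compl_inter, compl_compl]
      rw [this, Set.ncard_union_eq, ← Set.image_univ, Set.ncard_image_of_injective _ hinj,
        Set.ncard_univ, Nat.card_fin]
      rw [Set.disjoint_left]
      rintro _ hx ⟨i, rfl⟩
      exact hx (e i).2
    refine ⟨t + 1, ?_, ?_⟩
    · rw [hcard]
      push_cast
      linarith
    · have := M.numCycles_le_of_isCycle S hc
      rw [hcard]
      omega

/-- If fewer than `k` darts left a class, their edges could be deleted without disconnecting the
graph, but then no walk could leave the class. -/
theorem conn_mul_le [Finite V] [Finite E] (M : EmbeddedGraph V E) (S : Set E) {k : ℕ}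
    (hk : M.graph.EdgeConnected k) (hc : 2 ≤ Nat.card (Quotient (M.conn S))) :
    Nat.card (Quotient (M.conn S)) * k ≤ 2 * Sᶜ.ncard := by
  classical
  have := Fintype.ofFinite V
  have := Fintype.ofFinite E
  have := Fintype.ofFinite (Quotient (M.conn S))
  let cl : V → Quotient (M.conn S) := Quotient.mk _
  -- Darts are counted instead of edges, so that the sets of different classes are disjoint; the two
  -- darts of an edge account for the factor 2.
  let δ : Quotient (M.conn S) → Finset (E × Bool) := fun q =>
    {d | cl (M.tail d) = q ∧ cl (M.tail (rev d)) ≠ q}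
  have hδ : ∀ q, k ≤ (δ q).card := by
    intro q
    by_contra! hlt
    have hF := hk ((δ q).image Prod.fst) (Finset.card_image_le.trans_lt hlt)
    rw [Nat.card_eq_fintype_card] at hc
    obtain ⟨q', hq'⟩ := Fintype.exists_ne_of_one_lt_card hc q
    obtain ⟨x, rfl⟩ := Quotient.exists_rep q
    obtain ⟨y, rfl⟩ := Quotient.exists_rep q'
    have hxy := hF.2 x trivial y trivial
    refine hq' ?_
    clear hq'
    induction hxy with
    | refl => rfl
    | @tail y z _ hyz ih =>
      rw [← ih]
      obtain ⟨e, he⟩ := hyz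
      rw [Graph.deleteEdges_isLink] at he
      obtain ⟨⟨b, h1, h2⟩, he⟩ := he
      by_contra hne
      refine he (Finset.mem_coe.2 (Finset.mem_image.2 ⟨(e, b), ?_, rfl⟩))
      refine Finset.mem_filter.2 ⟨Finset.mem_univ _, ?_, ?_⟩
      · rw [h1]; exact ih
      · change cl (M.tail (e, !b)) ≠ _
        rw [h2, ← ih]; exact hne
  have hsum : ∑ q, (δ q).card ≤ 2 * Sᶜ.ncard := by
    rw [← Finset.card_biUnion]
    · have hsub : Finset.univ.biUnion δ ⊆ Sᶜ.toFinset ×ˢ Finset.univ := by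
        intro d hd
        obtain ⟨q, -, hd⟩ := Finset.mem_biUnion.1 hd
        obtain ⟨-, h1, h2⟩ := Finset.mem_filter.1 hd
        refine Finset.mem_product.2 ⟨Set.mem_toFinset.2 fun hS => h2 ?_, Finset.mem_univ _⟩
        rw [← h1]
        exact Quotient.sound ((M.conn S).symm (Joined.conn ⟨d, hS, rfl, rfl⟩))
      refine (Finset.card_le_card hsub).trans ?_
      rw [Finset.card_product, Set.ncard_eq_toFinset_card', Finset.card_univ, Fintype.card_bool,
        mul_comm]
    · intro p _ q _ hpq
      rw [Function.onFun, Finset.disjoint_left]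
      intro d h1 h2
      exact hpq ((Finset.mem_filter.1 h1).2.1.symm.trans (Finset.mem_filter.1 h2).2.1)
  refine le_trans ?_ hsum
  rw [Nat.card_eq_fintype_card, ← Finset.card_univ, ← smul_eq_mul]
  exact Finset.card_nsmul_le_sum _ _ _ fun q _ => hδ q

theorem CycleDeletion.numComponents_le [Finite V] [Finite E] {M : EmbeddedGraph V E} {k γ : ℕ}
    (hk : 0 < k) (hγ : 0 < γ) (hconn : M.graph.EdgeConnected k)
    (hχ : 2 - 2 * (γ : ℤ) ≤ M.eulerChar) {S : Set E}
    (h : M.CycleDeletion ((k : ℝ) / (3 * √(γ : ℝ))) S) :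
    ((M.keep S).graph.numComponents : ℝ) ≤ 2 * √(γ : ℝ) := by
  rw [numComponents_keep]
  set c := Nat.card (Quotient (M.conn S)) with hc
  have hγ1 : (1 : ℝ) ≤ γ := by exact_mod_cast hγ
  have hs1 : 1 ≤ √(γ : ℝ) := Real.one_le_sqrt.2 hγ1
  have hss : √(γ : ℝ) * √(γ : ℝ) = γ := Real.mul_self_sqrt (by positivity)
  set s := √(γ : ℝ)
  rcases Nat.lt_or_ge c 2 with hlt | hge
  · have : (c : ℝ) ≤ 1 := by exact_mod_cast Nat.lt_succ_iff.1 hlt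
    linarith
  have h1 : (c : ℝ) * k ≤ 2 * Sᶜ.ncard := by exact_mod_cast M.conn_mul_le S hconn hge
  obtain ⟨t, h2, h3⟩ := h.exists_count
  have h4 := M.euler_le S
  have h5 := Set.ncard_add_ncard_compl S
  have h6 : Nat.card M.Face = numCycles M.faceStep + Nat.card {x : V // ∀ d, M.tail d ≠ x} :=
    Nat.card_sum
  -- The Euler characteristic is at least `2 - 2γ + 2t` after the deletions and at most `2c`; the
  -- isolated vertices of the original graph cancel.
  have ht : t + 1 ≤ c + γ := by
    unfold eulerChar at hχ
    omega
  have ht' : (t : ℝ) + 1 ≤ c + γ := by exact_mod_cast ht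
  have hk' : (0 : ℝ) < k := by exact_mod_cast hk
  have h7 : (c : ℝ) * k ≤ 2 * (t * (k / (3 * s))) := by linarith
  have h8 : 2 * (t * (k / (3 * s))) = (2 * t / (3 * s)) * k := by field_simp
  rw [h8] at h7
  have h9 := le_of_mul_le_mul_right h7 hk'
  rw [le_div_iff₀ (by linarith)] at h9
  by_contra! hlt
  -- From `c > 2s` and `c(3s - 2) ≤ 2s² - 2` it would follow that `4s² - 4s + 2 < 0`.
  nlinarith [mul_lt_mul_of_pos_right hlt (by linarith : 0 < 3 * s - 2), sq_nonneg (s - 1)]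

end EmbeddedGraph

/-! ### Reasoning about programs -/

namespace RAM

/-- The arrays that a program writes to. -/
def Prog.writes : Prog → List ℕ
  | .nop => []
  | .write a _ _ => [a]
  | .seq P Q => P.writes ++ Q.writes
  | .ite _ P Q => P.writes ++ Q.writes
  | .loop _ P => P.writes

theorem Store.set_of_ne (μ : Store) {a b : ℕ} (i x : ℕ) (h : b ≠ a) : μ.set a i x b = μ b := by
  funext j
  simp [Store.set, h]

/-- As `writes` is computable, `decide` settles which arrays a program leaves unchanged. -/
theorem Exec.frame {P : Prog} {μ μ' : Store} {t : ℕ} (h : Exec P μ μ' t) :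
    ∀ a ∉ P.writes, μ' a = μ a := by
  induction h with
  | nop => exact fun _ _ => rfl
  | write μ a i x => exact fun b hb => Store.set_of_ne _ _ _ (by simpa [Prog.writes] using hb)
  | seq _ _ ih1 ih2 =>
    intro a ha
    simp only [Prog.writes, List.mem_append, not_or] at ha
    rw [ih2 a ha.2, ih1 a ha.1]
  | ite_true Q _ _ ih =>
    intro a ha
    simp only [Prog.writes, List.mem_append, not_or] at ha
    exact ih a ha.1
  | ite_false P _ _ ih =>
    intro a ha
    simp only [Prog.writes, List.mem_append, not_or] at ha
    exact ih a ha.2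
  | loop_done => exact fun _ _ => rfl
  | loop_step _ _ _ ih1 ih2 =>
    intro a ha
    rw [ih2 a ha, ih1 a ha]

/-- Started on `μ`, the program `P` halts within `T` steps with a store that satisfies `Q`. -/
def Runs (P : Prog) (μ : Store) (T : ℕ) (Q : Store → Prop) : Prop :=
  ∃ (μ' : Store) (t : ℕ), Exec P μ μ' t ∧ t ≤ T ∧ Q μ'

theorem Runs.mono {P : Prog} {μ : Store} {T T' : ℕ} {Q Q' : Store → Prop} (h : Runs P μ T Q)
    (hT : T ≤ T') (hQ : ∀ μ', (∀ a ∉ P.writes, μ' a = μ a) → Q μ' → Q' μ') : Runs P μ T' Q' := by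
  obtain ⟨μ', t, h1, h2, h3⟩ := h
  exact ⟨μ', t, h1, h2.trans hT, hQ μ' h1.frame h3⟩

theorem Runs.seq {P P' : Prog} {μ : Store} {T T' : ℕ} {Q R : Store → Prop} (h : Runs P μ T Q)
    (h' : ∀ μ', (∀ a ∉ P.writes, μ' a = μ a) → Q μ' → Runs P' μ' T' R) :
    Runs (.seq P P') μ (T + T') R := by
  obtain ⟨μ', t, h1, h2, h3⟩ := h
  obtain ⟨μ'', t', h4, h5, h6⟩ := h' μ' h1.frame h3
  exact ⟨μ'', t + t', h1.seq h4, by omega, h6⟩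

theorem Runs.ite {c : Expr} {P P' : Prog} {μ : Store} {T : ℕ} {Q : Store → Prop}
    (h : c.eval μ ≠ 0 → Runs P μ T Q) (h' : c.eval μ = 0 → Runs P' μ T Q) :
    Runs (.ite c P P') μ (1 + c.cost + T) Q := by
  by_cases hc : c.eval μ = 0
  · obtain ⟨μ', t, h1, h2, h3⟩ := h' hc
    exact ⟨μ', _, Exec.ite_false P hc h1, by omega, h3⟩
  · obtain ⟨μ', t, h1, h2, h3⟩ := h hc
    exact ⟨μ', _, Exec.ite_true P' hc h1, by omega, h3⟩

/-- The measure `f` bounds the number of remaining rounds; `F` is a bound for it that does not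
depend on the store. -/
theorem Runs.loop {c : Expr} {P : Prog} {T : ℕ} (Inv : Store → Prop) (f : Store → ℕ)
    (hstep : ∀ μ, Inv μ → c.eval μ ≠ 0 → Runs P μ T fun μ' => Inv μ' ∧ f μ' < f μ) {μ : Store}
    {F : ℕ} (hF : f μ ≤ F) (h : Inv μ) :
    Runs (.loop c P) μ (F * (1 + c.cost + T) + (1 + c.cost)) fun μ' => Inv μ' ∧ c.eval μ' = 0 := by
  induction F generalizing μ with
  | zero =>
    by_cases hc : c.eval μ = 0
    · exact ⟨μ, _, Exec.loop_done P hc, by omega, h, hc⟩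
    · obtain ⟨_, _, _, _, _, h3⟩ := hstep μ h hc
      omega
  | succ F ih =>
    by_cases hc : c.eval μ = 0
    · exact ⟨μ, _, Exec.loop_done P hc, by omega, h, hc⟩
    · obtain ⟨μ₁, t₁, h1, h2, h3, h4⟩ := hstep μ h hc
      obtain ⟨μ₂, t₂, h5, h6, h7⟩ := ih (by omega) h3
      refine ⟨μ₂, _, Exec.loop_step hc h1 h5, ?_, h7⟩
      rw [add_mul, one_mul]
      omega

/-! Programs without loops are evaluated directly. -/

def Prog.loopFree : Prog → Bool
  | .nop => true
  | .write _ _ _ => true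
  | .seq P Q => P.loopFree && Q.loopFree
  | .ite _ P Q => P.loopFree && Q.loopFree
  | .loop _ _ => false

/-- The result of a program without loops. -/
def Prog.run : Prog → Store → Store
  | .nop, μ => μ
  | .write a i x, μ => μ.set a (i.eval μ) (x.eval μ)
  | .seq P Q, μ => Q.run (P.run μ)
  | .ite c P Q, μ => if c.eval μ = 0 then Q.run μ else P.run μ
  | .loop _ _, μ => μ

theorem Prog.run_ite_pos {c : Expr} {P Q : Prog} {μ : Store} (h : c.eval μ ≠ 0) :
    (Prog.ite c P Q).run μ = P.run μ := if_neg h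

theorem Prog.run_ite_neg {c : Expr} {P Q : Prog} {μ : Store} (h : c.eval μ = 0) :
    (Prog.ite c P Q).run μ = Q.run μ := if_pos h

/-- A bound for the running time of a program without loops. -/
def Prog.time : Prog → ℕ
  | .nop => 1
  | .write _ i x => 1 + i.cost + x.cost
  | .seq P Q => P.time + Q.time
  | .ite c P Q => 1 + c.cost + max P.time Q.time
  | .loop _ _ => 0

theorem Prog.exec_run (P : Prog) (hP : P.loopFree = true) (μ : Store) :
    ∃ t, Exec P μ (P.run μ) t ∧ t ≤ P.time := by
  induction P generalizing μ with
  | nop => exact ⟨_, Exec.nop μ, le_rfl⟩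
  | write a i x => exact ⟨_, Exec.write μ a i x, le_rfl⟩
  | seq P Q ihP ihQ =>
    simp only [Prog.loopFree, Bool.and_eq_true] at hP
    obtain ⟨t, h1, h2⟩ := ihP hP.1 μ
    obtain ⟨t', h3, h4⟩ := ihQ hP.2 (P.run μ)
    exact ⟨_, h1.seq h3, Nat.add_le_add h2 h4⟩
  | ite c P Q ihP ihQ =>
    simp only [Prog.loopFree, Bool.and_eq_true] at hP
    by_cases hc : c.eval μ = 0
    · obtain ⟨t, h1, h2⟩ := ihQ hP.2 μ
      refine ⟨_, by rw [Prog.run, if_pos hc]; exact Exec.ite_false P hc h1, ?_⟩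
      simp only [Prog.time]
      omega
    · obtain ⟨t, h1, h2⟩ := ihP hP.1 μ
      refine ⟨_, by rw [Prog.run, if_neg hc]; exact Exec.ite_true Q hc h1, ?_⟩
      simp only [Prog.time]
      omega
  | loop c P _ => simp [Prog.loopFree] at hP

theorem Runs.of_run {P : Prog} {μ : Store} {T : ℕ} {Q : Store → Prop} (hP : P.loopFree = true)
    (hT : P.time ≤ T) (h : Q (P.run μ)) : Runs P μ T Q := by
  obtain ⟨t, h1, h2⟩ := P.exec_run hP μ
  exact ⟨_, t, h1, h2.trans hT, h⟩

theorem Runs.seq_run {P P' : Prog} {μ : Store} {T : ℕ} {Q : Store → Prop}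
    (hP : P.loopFree = true) (h : Runs P' (P.run μ) T Q) : Runs (.seq P P') μ (P.time + T) Q :=
  (Runs.of_run (Q := fun μ' => μ' = P.run μ) hP le_rfl rfl).seq fun _ _ hμ => hμ ▸ h

/-- The scalar variable that is kept in cell `0` of array `a`. -/
abbrev var (a : ℕ) : Expr := .read a (.const 0)

/-- Assignment to a scalar variable. -/
abbrev assign (a : ℕ) (x : Expr) : Prog := .write a (.const 0) x

/-- `for a = 0, 1, …, c - 1 do B`. -/
def forLoop (a : ℕ) (c : Expr) (B : Prog) : Prog :=
  .seq (assign a (.const 0))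
    (.loop (.sub c (var a)) (.seq B (assign a (.add (var a) (.const 1)))))

/-- The invariant for `j + 1` is required after the counter has been increased. Each round may also
use that the arrays not written to are still those of the initial store. -/
theorem Runs.forLoop {a : ℕ} {c : Expr} {B : Prog} {T N : ℕ} {μ : Store} (Inv : ℕ → Store → Prop)
    (ha : a ∉ B.writes)
    (hN : ∀ μ' : Store, (∀ b, b ≠ a → b ∉ B.writes → μ' b = μ b) → c.eval μ' = N)
    (h0 : Inv 0 (μ.set a 0 0))
    (hstep : ∀ j < N, ∀ μ' : Store, (∀ b, b ≠ a → b ∉ B.writes → μ' b = μ b) → μ' a 0 = j →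
      Inv j μ' → Runs B μ' T fun μ'' => Inv (j + 1) (μ''.set a 0 (j + 1))) :
    Runs (forLoop a c B) μ (N * (T + c.cost + 10) + c.cost + 7) (Inv N) := by
  have hloop := Runs.loop (c := .sub c (var a)) (P := .seq B (assign a (.add (var a) (.const 1))))
    (T := T + 6)
    (fun μ' => (∀ b, b ≠ a → b ∉ B.writes → μ' b = μ b) ∧ μ' a 0 ≤ N ∧ Inv (μ' a 0) μ')
    (fun μ' => N - μ' a 0) ?_ (μ := μ.set a 0 0) (F := N) (Nat.sub_le _ _) ?_
  · have hinit : Runs (assign a (.const 0)) μ 3 fun μ' => μ' = μ.set a 0 0 :=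
      ⟨_, _, Exec.write μ a (.const 0) (.const 0), le_rfl, rfl⟩
    refine (hinit.seq (T' := _) (R := Inv N) ?_).mono (T := 3 + (N * (1 + (c.cost + 3) + (T + 6)) +
      (1 + (c.cost + 3)))) ?_ fun μ' _ h => h
    · rintro μ' - rfl
      refine hloop.mono ?_ ?_
      · simp only [Expr.cost]
        exact le_of_eq (by ring)
      rintro μ' - ⟨⟨h1, h2, h3⟩, h4⟩
      have h5 : μ' a 0 = N := by
        have h4 : c.eval μ' - μ' a 0 = 0 := h4
        rw [hN μ' h1] at h4
        omega
      rwa [h5] at h3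
    · exact le_of_eq (by ring)
  · rintro μ' ⟨h1, h2, h3⟩ h4
    have h4 : c.eval μ' - μ' a 0 ≠ 0 := h4
    rw [hN μ' h1] at h4
    refine Runs.seq (hstep _ (by omega) μ' h1 rfl h3) ?_
    intro μ'' hf h5
    refine Runs.of_run rfl le_rfl ?_
    have ha0 : μ'' a 0 = μ' a 0 := by rw [hf a ha]
    have hrun : (assign a (.add (var a) (.const 1))).run μ'' = μ''.set a 0 (μ' a 0 + 1) := by
      simp [Prog.run, Expr.eval, ha0]
    have hval : μ''.set a 0 (μ' a 0 + 1) a 0 = μ' a 0 + 1 := by simp [Store.set]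
    rw [hrun, hval]
    refine ⟨⟨fun b hb hbB => ?_, by omega, h5⟩, by omega⟩
    rw [Store.set_of_ne _ _ _ hb, hf b hbB, h1 b hb hbB]
  · refine ⟨fun b hb _ => Store.set_of_ne _ _ _ hb, ?_, ?_⟩
    · simp [Store.set]
    · simpa [Store.set] using h0

end RAM

namespace RAM

open EmbeddedGraph

variable {n m : ℕ}

/-! ### Tables of dart reversal and of the edges of darts -/

theorem dartCode_lt (d : Fin m × Bool) : dartCode d < 2 * m := by
  obtain ⟨e, b⟩ := d
  have := e.2
  cases b <;> (simp only [dartCode, Bool.toNat_true, Bool.toNat_false]; omega)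

theorem dartOfCode_dartCode (d : Fin m × Bool) (h : dartCode d < 2 * m) :
    dartOfCode (dartCode d) h = d := by
  obtain ⟨e, b⟩ := d
  cases b <;> (simp [dartCode, dartOfCode]; try (ext; simp; omega))

theorem dartCode_dartOfCode (i : ℕ) (h : i < 2 * m) : dartCode (dartOfCode i h) = i := by
  rcases Nat.mod_two_eq_zero_or_one i with h' | h' <;> simp [dartCode, dartOfCode, h'] <;> omega

theorem dartCode_injective : Function.Injective (dartCode (m := m)) := fun d d' h => by
  rw [← dartOfCode_dartCode d (dartCode_lt d), ← dartOfCode_dartCode d' (dartCode_lt d')]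
  simp only [h]

theorem dartCode_false (e : Fin m) : dartCode (e, false) = e + e := by
  simp [dartCode]; omega

theorem dartCode_true (e : Fin m) : dartCode (e, true) = e + e + 1 := by
  simp [dartCode]; omega

/-- The store holds the number of edges and the tables of the rotation, of dart reversal, and of
the edges of the darts. -/
structure Tables (M : EmbeddedGraph (Fin n) (Fin m)) (μ : Store) : Prop where
  size : μ 0 1 = m
  rot : ∀ d, μ 2 (dartCode d) = dartCode (M.rot d)
  rev : ∀ d : Fin m × Bool, μ 7 (dartCode d) = dartCode (rev d)
  edge : ∀ d : Fin m × Bool, μ 8 (dartCode d) = d.1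

theorem Tables.congr {M : EmbeddedGraph (Fin n) (Fin m)} {μ μ' : Store} (h : Tables M μ)
    (h0 : μ' 0 = μ 0) (h2 : μ' 2 = μ 2) (h7 : μ' 7 = μ 7) (h8 : μ' 8 = μ 8) : Tables M μ' where
  size := by rw [h0, h.size]
  rot := by rw [h2]; exact h.rot
  rev := by rw [h7]; exact h.rev
  edge := by rw [h8]; exact h.edge

abbrev numEdges : Expr := .read 0 (.const 1)

abbrev numDarts : Expr := .add numEdges numEdges

/-- Array `7` tabulates the reversal of darts, array `8` the edges of the darts. -/
def buildTables : Prog :=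
  forLoop 14 numEdges
    (.seq (.write 7 (.add (var 14) (var 14)) (.add (.add (var 14) (var 14)) (.const 1)))
    (.seq (.write 7 (.add (.add (var 14) (var 14)) (.const 1)) (.add (var 14) (var 14)))
    (.seq (.write 8 (.add (var 14) (var 14)) (var 14))
      (.write 8 (.add (.add (var 14) (var 14)) (.const 1)) (var 14)))))

theorem runs_buildTables (M : EmbeddedGraph (Fin n) (Fin m)) (μ : Store) (h0 : μ 0 1 = m)
    (h2 : ∀ d, μ 2 (dartCode d) = dartCode (M.rot d)) :
    Runs buildTables μ (m * 62 + 9) (Tables M) := by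
  refine (Runs.forLoop (T := 50) (N := m) (fun j μ' => μ' 0 = μ 0 ∧ μ' 2 = μ 2 ∧
    ∀ d : Fin m × Bool, (d.1 : ℕ) < j →
      μ' 7 (dartCode d) = dartCode (rev d) ∧ μ' 8 (dartCode d) = d.1) (by decide) ?_ ?_ ?_).mono
    ?_ ?_
  · intro μ' hf
    simp only [Expr.eval]
    rw [hf 0 (by decide) (by decide), h0]
  · exact ⟨rfl, rfl, by simp⟩
  · intro j hj μ' hf hj0 ⟨h0', h2', h⟩
    refine Runs.of_run (by decide) (by decide) ⟨?_, ?_, ?_⟩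
    · rw [← h0']; rfl
    · rw [← h2']; rfl
    · rintro ⟨e, b⟩ he
      have he' : (e : ℕ) < j ∨ (e : ℕ) = j := Nat.lt_succ_iff_lt_or_eq.1 he
      rcases he' with he' | he'
      · have := h (e, b) he'
        have h1 : dartCode (e, b) ≠ j + j := by cases b <;> (simp [dartCode]; omega)
        have h2 : dartCode (e, b) ≠ j + j + 1 := by cases b <;> (simp [dartCode]; omega)
        simpa [Prog.run, Expr.eval, Store.set, hj0, h1, h2] using this
      · cases b
        · simp [Prog.run, Expr.eval, Store.set, hj0, EmbeddedGraph.rev, dartCode_false,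
            dartCode_true, he']
        · simp [Prog.run, Expr.eval, Store.set, hj0, EmbeddedGraph.rev, dartCode_false,
            dartCode_true, he']
  · simp [Expr.cost]
  · rintro μ' - ⟨h0', h2', h⟩
    exact ⟨by rw [h0', h0], by rw [h2']; exact h2, fun d => (h d d.1.2).1, fun d => (h d d.1.2).2⟩

/-! ### The largest admissible cycle length -/

/-- Array `20` is filled with the powers of two up to the first one above `k`, array `21` with the
products of these powers with `k`. Scalar `22` is the last exponent. -/
def doubleUp : Prog :=
  .loop (.sub (.add (.read 0 (.const 2)) (.const 1)) (.read 20 (var 22)))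
    (.seq (.write 20 (.add (var 22) (.const 1)) (.add (.read 20 (var 22)) (.read 20 (var 22))))
    (.seq (.write 21 (.add (var 22) (.const 1)) (.add (.read 21 (var 22)) (.read 21 (var 22))))
      (assign 22 (.add (var 22) (.const 1)))))

/-- The powers of two that add up to scalar `23` are subtracted from it, and the corresponding
entries of array `21` are added to scalar `24`. -/
def sumDigits : Prog :=
  .loop (var 22)
    (.seq (assign 22 (.sub (var 22) (.const 1)))
    (.ite (.sub (.add (var 23) (.const 1)) (.read 20 (var 22)))
      (.seq (assign 23 (.sub (var 23) (.read 20 (var 22))))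
        (assign 24 (.add (var 24) (.read 21 (var 22)))))
      .nop))

/-- Scalar `24` becomes the square of `k`. -/
def squareK : Prog :=
  .seq (.seq (assign 22 (.const 0)) (.seq (.write 20 (.const 0) (.const 1))
    (.write 21 (.const 0) (.read 0 (.const 2)))))
  (.seq doubleUp
  (.seq (.seq (assign 23 (.read 0 (.const 2))) (assign 24 (.const 0)))
    sumDigits))

theorem runs_doubleUp (μ : Store) (k : ℕ) (hk : μ 0 2 = k) (h22 : μ 22 0 = 0) (h20 : μ 20 0 = 1)
    (h21 : μ 21 0 = k) : Runs doubleUp μ (k.size * 49 + 9) fun μ' => k < 2 ^ μ' 22 0 ∧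
      μ' 22 0 ≤ k.size ∧ ∀ j ≤ μ' 22 0, μ' 20 j = 2 ^ j ∧ μ' 21 j = k * 2 ^ j := by
  refine (Runs.loop (T := 40) (F := k.size) (fun μ' => μ' 0 2 = k ∧ μ' 22 0 ≤ k.size ∧
    ∀ j ≤ μ' 22 0, μ' 20 j = 2 ^ j ∧ μ' 21 j = k * 2 ^ j) (fun μ' => k.size - μ' 22 0) ?_
    (Nat.sub_le _ _) ?_).mono ?_ ?_
  · rintro μ' ⟨h1, h2, h3⟩ h4
    simp only [Expr.eval, h1, (h3 _ le_rfl).1] at h4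
    -- The loop test says that the current power of two is at most `k`, so there are at most as many
    -- rounds as `k` has binary digits.
    have hlt : μ' 22 0 < k.size := Nat.lt_size.2 (by omega)
    have h5 := h3 _ le_rfl
    refine Runs.of_run (by decide) (by decide) ?_
    simp [Prog.run, Expr.eval, Store.set, h1, h5]
    refine ⟨⟨hlt, fun j hj => ?_⟩, by omega⟩
    by_cases hj' : j = μ' 22 0 + 1
    · subst hj'
      simp
      constructor <;> ring
    · simp [hj', h3 j (by omega)]
  · simp [hk, h22, h20, h21]
  · simp only [Expr.cost]
    omega
  · rintro μ' - ⟨⟨h1, h2, h3⟩, h4⟩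
    simp only [Expr.eval, h1, (h3 _ le_rfl).1] at h4
    exact ⟨by omega, h2, h3⟩

/-- Binary multiplication: accumulator plus remainder times `k` is always `k * k`, and the remainder
is less than the current power of two, hence zero at the end. -/
theorem runs_sumDigits (μ : Store) (k : ℕ) (h23 : μ 23 0 = k) (h24 : μ 24 0 = 0)
    (hlt : k < 2 ^ μ 22 0) (hsize : μ 22 0 ≤ k.size)
    (hpow : ∀ j ≤ μ 22 0, μ 20 j = 2 ^ j ∧ μ 21 j = k * 2 ^ j) :
    Runs sumDigits μ (k.size * 43 + 3) fun μ' => μ' 24 0 = k * k := by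
  refine (Runs.loop (T := 40) (F := k.size)
    (fun μ' => (∀ j ≤ μ' 22 0, μ' 20 j = 2 ^ j ∧ μ' 21 j = k * 2 ^ j) ∧
      μ' 23 0 < 2 ^ μ' 22 0 ∧ μ' 24 0 + μ' 23 0 * k = k * k)
    (fun μ' => μ' 22 0) ?_ hsize ?_).mono ?_ ?_
  · rintro μ' ⟨h1, h2, h3⟩ h4
    simp only [Expr.eval] at h4
    obtain ⟨i, hi⟩ : ∃ i, μ' 22 0 = i + 1 := ⟨μ' 22 0 - 1, by omega⟩
    rw [hi] at h1 h2
    have h5 := h1 i (by omega)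
    rw [pow_succ] at h2
    refine Runs.of_run (by decide) (by decide) ?_
    have h1' : ∀ j ≤ i, μ' 20 j = 2 ^ j ∧ μ' 21 j = k * 2 ^ j := fun j hj => h1 j (by omega)
    by_cases hr : 2 ^ i ≤ μ' 23 0
    · obtain ⟨q, hq⟩ := Nat.exists_eq_add_of_le hr
      have hz : ¬ (2 ^ i + q + 1 - 2 ^ i = 0) := by omega
      have : μ' 24 0 + k * 2 ^ i + q * k = k * k := by rw [← h3, hq]; ring
      rw [Prog.run, Prog.run_ite_pos]
      · simp only [Prog.run, Expr.eval, Store.set]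
        simp [hi, h5, hq, this]
        exact ⟨h1', by omega⟩
      · simpa [Prog.run, Expr.eval, Store.set, hi, h5, hq] using hz
    · have hz : μ' 23 0 + 1 - 2 ^ i = 0 := by omega
      rw [Prog.run, Prog.run_ite_neg]
      · simp only [Prog.run, Expr.eval, Store.set]
        simp [hi, h3]
        exact ⟨h1', by omega⟩
      · simpa [Prog.run, Expr.eval, Store.set, hi, h5] using hz
  · exact ⟨hpow, by rwa [h23], by rw [h23, h24, zero_add]⟩
  · simp only [Expr.cost]
    omega
  · rintro μ' - ⟨⟨-, h5, h6⟩, h7⟩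
    simp only [Expr.eval] at h7
    rw [h7, pow_zero, Nat.lt_one_iff] at h5
    rw [h5] at h6
    omega

/-- There is no multiplication instruction, and the time has to be linear in the binary length of
`k`, not in `k`. -/
theorem runs_squareK (μ : Store) (k : ℕ) (hk : μ 0 2 = k) :
    Runs squareK μ (k.size * 92 + 40) fun μ' => μ' 24 0 = k * k := by
  refine (Runs.seq_run rfl (Runs.seq (runs_doubleUp _ k ?_ ?_ ?_ ?_) fun μ₁ hf h => Runs.seq_run rfl
    (runs_sumDigits _ k ?_ ?_ ?_ ?_ ?_))).mono ?_ fun _ _ h => h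
  · exact hk
  · rfl
  · rfl
  · exact hk
  · rw [← hk]
    exact congrFun (hf 0 (by decide)) 2
  · rfl
  · exact h.1
  · exact h.2.1
  · exact h.2.2
  · simp only [Prog.time, Expr.cost]
    omega

/-- Scalar `17` becomes the largest `ℓ ≤ m` with `9 γ ℓ ^ 2 < k ^ 2`. -/
def maxLength : Prog :=
  .seq (.seq (assign 26 (.add (.read 0 (.const 3)) (.add (.read 0 (.const 3)) (.read 0 (.const 3)))))
    (.seq (assign 25 (.add (var 26) (.add (var 26) (var 26))))
    (.seq (assign 27 (.add (var 25) (var 25)))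
    (.seq (assign 26 (.add (var 25) (var 27)))
      (assign 17 (.const 0))))))
  (forLoop 14 numEdges
    (.seq (.ite (.sub (var 24) (var 25)) (assign 17 (.add (var 17) (.const 1))) .nop)
    (.seq (assign 25 (.add (var 25) (var 26)))
      (assign 26 (.add (var 26) (var 27))))))

/-- The values `9γ(j + 1)²` are generated by differences: scalar `26` is the next increment and
scalar `27` the constant second difference `18γ`. -/
theorem runs_maxLength (μ : Store) (m k γ : ℕ) (hk : 0 < k) (hm : μ 0 1 = m) (hγ : μ 0 3 = γ)
    (hkk : μ 24 0 = k * k) :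
    Runs maxLength μ (m * 52 + 60) fun μ' => μ' 17 0 ≤ m ∧
      ∀ ℓ ≤ m, ℓ ≤ μ' 17 0 ↔ 9 * γ * ℓ ^ 2 < k * k := by
  refine (Runs.seq_run rfl (Runs.forLoop (T := 40) (N := m) (fun j μ' => μ' 24 0 = k * k ∧
      μ' 27 0 = 18 * γ ∧ μ' 25 0 = 9 * γ * (j + 1) ^ 2 ∧ μ' 26 0 = 9 * γ * (2 * j + 3) ∧
      μ' 17 0 ≤ j ∧ ∀ ℓ ≤ j, ℓ ≤ μ' 17 0 ↔ 9 * γ * ℓ ^ 2 < k * k) (by decide) ?_ ?_ ?_)).mono ?_ ?_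
  · intro μ' hf
    simp only [Expr.eval]
    rw [hf 0 (by decide) (by decide)]
    exact hm
  -- Length zero is admissible because `k` is positive.
  · simp [Prog.run, Expr.eval, Store.set, hγ, hkk, hk]
    omega
  · rintro j hj μ' - - ⟨h1, h2, h3, h4, h5, h6⟩
    refine Runs.of_run (by decide) (by decide) ?_
    have h7 : 9 * γ * (j + 1) ^ 2 + 9 * γ * (2 * j + 3) = 9 * γ * (j + 1 + 1) ^ 2 := by ring
    have h8 : 9 * γ * (2 * j + 3) + 18 * γ = 9 * γ * (2 * (j + 1) + 3) := by ring
    by_cases hlt : 9 * γ * (j + 1) ^ 2 < k * k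
    · have hz : ¬ (μ' 24 0 - μ' 25 0 = 0) := by omega
      have hmono : ∀ ℓ ≤ j + 1, 9 * γ * ℓ ^ 2 < k * k := fun ℓ hℓ =>
        lt_of_le_of_lt (Nat.mul_le_mul_left _ (Nat.pow_le_pow_left hℓ 2)) hlt
      have h9 : μ' 17 0 = j := le_antisymm h5 ((h6 j le_rfl).2 (hmono j (by omega)))
      rw [Prog.run, Prog.run_ite_pos (c := .sub (var 24) (var 25)) hz]
      simp only [Prog.run, Expr.eval, Store.set]
      simp [h9, h7, h8, h1, h2, h3, h4]
      exact fun ℓ hℓ => ⟨fun _ => hmono ℓ hℓ, fun _ => hℓ⟩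
    · have hz : μ' 24 0 - μ' 25 0 = 0 := by omega
      rw [Prog.run, Prog.run_ite_neg (c := .sub (var 24) (var 25)) hz]
      simp only [Prog.run, Expr.eval, Store.set]
      simp [h7, h8, h1, h2, h3, h4]
      refine ⟨by omega, fun ℓ hℓ => ?_⟩
      rcases Nat.le_succ_iff.1 hℓ with hℓ | rfl
      · exact h6 ℓ hℓ
      · exact ⟨fun h => absurd (h.trans h5) (by omega), fun h => absurd h hlt⟩
  · simp only [Prog.time, Expr.cost]
    omega
  · rintro μ' - ⟨-, -, -, -, h5, h6⟩
    exact ⟨h5, h6⟩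

end RAM

/-- Up to the least exponent that reaches `y` the iterates are distinct. Hence a walk of as many
steps as there are darts sees the whole cycle. -/
theorem exists_pow_eq_of_sameCycle {α : Type*} [Finite α] {σ : Equiv.Perm α} {x y : α}
    (h : σ.SameCycle x y) : ∃ i < Nat.card α, (σ ^ i) x = y := by
  classical
  have hex : ∃ i, (σ ^ i) x = y := h.exists_nat_pow_eq
  refine ⟨Nat.find hex, ?_, Nat.find_spec hex⟩
  have hinj : Function.Injective fun j : Fin (Nat.find hex + 1) => (σ ^ (j : ℕ)) x := by
    have key : ∀ a b : ℕ, a < b → b ≤ Nat.find hex → (σ ^ a) x ≠ (σ ^ b) x := by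
      intro a b hab hb he
      refine Nat.find_min hex (m := Nat.find hex - b + a) (by omega) ?_
      rw [pow_add, Equiv.Perm.mul_apply, he, ← Equiv.Perm.mul_apply, ← pow_add,
        Nat.sub_add_cancel hb]
      exact Nat.find_spec hex
    intro a b hab
    rcases lt_trichotomy a b with hlt | heq | hlt
    · exact absurd hab (key a b hlt (by omega))
    · exact heq
    · exact absurd hab.symm (key b a hlt (by omega))
  have := Nat.card_le_card_of_injective _ hinj
  rw [Nat.card_fin] at this
  exact this

namespace RAM

open EmbeddedGraph

variable {n m : ℕ}

/-! ### Labels of the faces -/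

/-- The table `f` assigns to each dart the least dart in its cycle of `walkPerm`. -/
def IsLabeling (M : EmbeddedGraph (Fin n) (Fin m)) (S : Set (Fin m)) (f : ℕ → ℕ) : Prop :=
  ∀ d, ∃ d', f (dartCode d) = dartCode d' ∧ (M.walkPerm S).SameCycle d d' ∧
    ∀ d'', (M.walkPerm S).SameCycle d d'' → dartCode d' ≤ dartCode d''

theorem IsLabeling.lt {M : EmbeddedGraph (Fin n) (Fin m)} {S : Set (Fin m)} {f : ℕ → ℕ}
    (h : IsLabeling M S f) (d : Fin m × Bool) : f (dartCode d) < 2 * m := by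
  obtain ⟨d', h1, -⟩ := h d
  rw [h1]
  exact dartCode_lt d'

theorem IsLabeling.eq_iff {M : EmbeddedGraph (Fin n) (Fin m)} {S : Set (Fin m)} {f : ℕ → ℕ}
    (h : IsLabeling M S f) (d₁ d₂ : Fin m × Bool) :
    f (dartCode d₁) = f (dartCode d₂) ↔ (M.walkPerm S).SameCycle d₁ d₂ := by
  obtain ⟨d₁', h1, h2, h3⟩ := h d₁
  obtain ⟨d₂', h4, h5, h6⟩ := h d₂
  rw [h1, h4]
  constructor
  · intro h
    rw [dartCode_injective h] at h2
    exact h2.trans h5.symm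
  · intro h
    exact le_antisymm (h3 _ (h.trans h5)) (h6 _ (h.symm.trans h2))

/-- One step of `walkPerm` for scalar `11`; scalar `12` is the least dart met so far. -/
def walkStep : Prog :=
  .seq (.ite (.read 3 (.read 8 (var 11))) (assign 11 (.read 2 (var 11)))
      (assign 11 (.read 2 (.read 7 (var 11)))))
    (.ite (.sub (var 12) (var 11)) (assign 12 (var 11)) .nop)

/-- Array `4` becomes the table of face labels. -/
def computeLabels : Prog :=
  forLoop 10 numDarts
    (.seq (.seq (assign 11 (var 10)) (assign 12 (var 10)))
    (.seq (forLoop 13 numDarts walkStep) (.write 4 (var 10) (var 12))))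

theorem mem_keptEdges {μ : Store} {e : Fin m} : e ∈ keptEdges m μ ↔ μ 3 e = 0 := Iff.rfl

theorem keptEdges_congr {μ μ' : Store} (h : μ' 3 = μ 3) : keptEdges m μ' = keptEdges m μ := by
  ext e
  rw [mem_keptEdges, mem_keptEdges, h]

theorem runs_walkStep (M : EmbeddedGraph (Fin n) (Fin m)) (μ : Store) (hμ : Tables M μ)
    (d d' : Fin m × Bool) (h11 : μ 11 0 = dartCode d) (h12 : μ 12 0 = dartCode d') :
    Runs walkStep μ 23 fun μ' => μ' 11 0 = dartCode (M.walkPerm (keptEdges m μ) d) ∧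
      μ' 12 0 = min (dartCode d') (dartCode (M.walkPerm (keptEdges m μ) d)) := by
  refine (Runs.seq (T := 12) (Q := fun μ' => μ' 11 0 = dartCode (M.walkPerm (keptEdges m μ) d))
    (Runs.ite (T := 7) (fun h => ?_) fun h => ?_) (T' := 11) fun μ₁ hf h1 =>
    Runs.ite (T := 5) (fun h => ?_) fun h => ?_).mono le_rfl fun _ _ h => h
  · have h : μ 3 (μ 8 (μ 11 0)) ≠ 0 := h
    rw [h11, hμ.edge] at h
    refine Runs.of_run rfl (by decide) ?_
    rw [M.walkPerm_of_notMem (fun hd => h (mem_keptEdges.1 hd)), ← hμ.rot, ← h11]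
    rfl
  · have h : μ 3 (μ 8 (μ 11 0)) = 0 := h
    rw [h11, hμ.edge] at h
    refine Runs.of_run rfl (by decide) ?_
    rw [M.walkPerm_of_mem (mem_keptEdges.2 h), ← hμ.rot, ← hμ.rev, ← h11]
    rfl
  · have h : μ₁ 12 0 - μ₁ 11 0 ≠ 0 := h
    rw [hf 12 (by decide), h1, h12] at h
    refine Runs.of_run rfl (by decide) ⟨h1, ?_⟩
    rw [min_eq_right (by omega), ← h1]
    rfl
  · have h : μ₁ 12 0 - μ₁ 11 0 = 0 := h
    rw [hf 12 (by decide), h1, h12] at h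
    refine Runs.of_run rfl (by decide) ⟨h1, ?_⟩
    rw [min_eq_left (by omega), ← h12, ← hf 12 (by decide)]
    rfl

theorem runs_computeLabels (M : EmbeddedGraph (Fin n) (Fin m)) (μ : Store) (hμ : Tables M μ) :
    Runs computeLabels μ (2 * m * (2 * m * 41 + 50) + 12) fun μ' =>
      IsLabeling M (keptEdges m μ) (μ' 4) := by
  set σ := M.walkPerm (keptEdges m μ) with hσ
  have hsize : ∀ μ' : Store, μ' 0 = μ 0 → numDarts.eval μ' = 2 * m := by
    intro μ' h
    simp only [Expr.eval]
    rw [h, hμ.size]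
    omega
  refine (Runs.forLoop (T := 2 * m * 41 + 35) (N := 2 * m) (fun j μ' => ∀ d, dartCode d < j →
    ∃ d', μ' 4 (dartCode d) = dartCode d' ∧ σ.SameCycle d d' ∧
      ∀ d'', σ.SameCycle d d'' → dartCode d' ≤ dartCode d'') (by decide)
    (fun μ' hf => hsize μ' (hf 0 (by decide) (by decide))) (by simp) ?_).mono ?_ ?_
  · intro j hj μ₁ hf h10 hinv
    obtain ⟨d, rfl⟩ : ∃ d : Fin m × Bool, dartCode d = j := ⟨_, dartCode_dartOfCode j hj⟩
    -- After `i` steps scalar `12` is the least code among the first `i + 1` darts of the orbit;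
    -- `2m` steps exhaust the cycle.
    refine (Runs.seq_run rfl (Runs.seq (Runs.forLoop (T := 26) (N := 2 * m)
      (fun i μ' => μ' 11 0 = dartCode ((σ ^ i) d) ∧ ∃ d', μ' 12 0 = dartCode d' ∧
        σ.SameCycle d d' ∧ ∀ i' ≤ i, dartCode d' ≤ dartCode ((σ ^ i') d)) (by decide) ?_ ?_ ?_)
      (T' := 5) fun μ₂ hf₂ h₂ => Runs.of_run rfl (by decide) ?_)).mono ?_ fun _ _ h => h
    · refine fun μ' hf' => hsize μ' ?_
      rw [hf' 0 (by decide) (by decide), ← hf 0 (by decide) (by decide)]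
      rfl
    · refine ⟨by simpa [Prog.run, Expr.eval, Store.set] using h10, d,
        by simpa [Prog.run, Expr.eval, Store.set] using h10, Equiv.Perm.SameCycle.refl _ _, ?_⟩
      intro i hi
      rw [Nat.le_zero.1 hi, pow_zero, Equiv.Perm.one_apply]
    · rintro i - μ₂ hf₂ - ⟨h1, d', h2, h3, h4⟩
      have hf₃ : ∀ b ∉ [4, 10, 11, 12, 13], μ₂ b = μ b := by
        intro b hb
        simp only [List.mem_cons, List.not_mem_nil, or_false, not_or] at hb
        rw [hf₂ b (by tauto) (by simp [walkStep, Prog.writes]; tauto),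
          ← hf b (by tauto) (by simp [walkStep, forLoop, Prog.writes]; tauto)]
        simp [Prog.run, Store.set_of_ne, hb]
      refine (runs_walkStep M μ₂ (hμ.congr (hf₃ 0 (by decide)) (hf₃ 2 (by decide))
        (hf₃ 7 (by decide)) (hf₃ 8 (by decide))) _ _ h1 h2).mono (by omega) ?_
      rintro μ₃ - ⟨h5, h6⟩
      rw [keptEdges_congr (hf₃ 3 (by decide)), ← hσ, ← Equiv.Perm.mul_apply, ← pow_succ'] at h5 h6
      refine ⟨h5, ?_⟩
      change ∃ d', μ₃ 12 0 = _ ∧ _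
      rcases le_total (dartCode d') (dartCode ((σ ^ (i + 1)) d)) with hle | hle
      · rw [min_eq_left hle] at h6
        refine ⟨d', h6, h3, fun i' hi' => ?_⟩
        rcases Nat.le_succ_iff.1 hi' with hi' | rfl
        · exact h4 i' hi'
        · exact hle
      · rw [min_eq_right hle] at h6
        refine ⟨_, h6, ⟨(i + 1 : ℕ), by rw [zpow_natCast]⟩, fun i' hi' => ?_⟩
        rcases Nat.le_succ_iff.1 hi' with hi' | rfl
        · exact hle.trans (h4 i' hi')
        · exact le_rfl
    · obtain ⟨-, d', h2, h3, h4⟩ := h₂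
      have h10' : μ₂ 10 0 = dartCode d := by
        rw [hf₂ 10 (by decide), ← h10]
        rfl
      have h4' : μ₂ 4 = μ₁ 4 := by
        rw [hf₂ 4 (by decide)]
        rfl
      intro c hc
      by_cases hcd : c = d
      · subst hcd
        refine ⟨d', by simp [Prog.run, Expr.eval, Store.set, h10', h2], h3, fun d'' h => ?_⟩
        obtain ⟨i, hi, rfl⟩ := exists_pow_eq_of_sameCycle h
        refine h4 i ?_
        rw [Nat.card_prod, Nat.card_fin, Nat.card_eq_fintype_card, Fintype.card_bool] at hi
        omega
      · have hne : dartCode c ≠ dartCode d := fun h => hcd (dartCode_injective h)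
        obtain ⟨d', h5, h6⟩ := hinv c (by omega)
        refine ⟨d', ?_, h6⟩
        simp [Prog.run, Expr.eval, Store.set, h10', hne, h4', h5]
    · simp only [Prog.time, Expr.cost]
      omega
  · simp only [Expr.cost]
    exact le_of_eq (by ring)
  · exact fun μ' _ h d => h d (dartCode_lt d)

end RAM

namespace RAM

open EmbeddedGraph

variable {n m : ℕ}

/-! ### Breadth-first search in the dual graph -/

/-- The state of a breadth-first search from `s` along the darts that satisfy `A`, where a dart `d`
leads from `lab d` to `lab (rev d)`. Reached vertices have a positive value of `D`, namely their
distance from `s` plus one, and `P` holds the dart by which they were reached. All darts that leave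
vertices with `D ≤ r`, and those with code less than `j` that leave vertices with `D = r + 1`, have
been scanned. -/
structure SearchState (lab : Fin m × Bool → ℕ) (A : Fin m × Bool → Prop) (s r j : ℕ)
    (D P : ℕ → ℕ) : Prop where
  source : D s = 1
  eq_source : ∀ x < 2 * m, D x = 1 → x = s
  le : ∀ x < 2 * m, D x ≤ r + 2
  scanned : ∀ d, A d → D (lab d) ≠ 0 → D (lab d) ≤ r ∨ (D (lab d) = r + 1 ∧ dartCode d < j) →
    D (lab (rev d)) ≠ 0 ∧ D (lab (rev d)) ≤ D (lab d) + 1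
  pred : ∀ x < 2 * m, 2 ≤ D x →
    ∃ d, A d ∧ P x = dartCode d ∧ lab (rev d) = x ∧ D (lab d) + 1 = D x

variable {lab : Fin m × Bool → ℕ} {A : Fin m × Bool → Prop} {s r : ℕ} {D P : ℕ → ℕ}

theorem SearchState.nextRound (h : SearchState lab A s r (2 * m) D P) :
    SearchState lab A s (r + 1) 0 D P where
  source := h.source
  eq_source := h.eq_source
  le x hx := (h.le x hx).trans (by omega)
  scanned d hd h0 hr := h.scanned d hd h0 (by
    have := dartCode_lt d
    omega)
  pred := h.pred

/-- A dart needs no action if its target is already reached: the bound on the distance of the target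
is then the general bound `r + 2`. -/
theorem SearchState.skip {d : Fin m × Bool} (h : SearchState lab A s r (dartCode d) D P)
    (hlab : ∀ d, lab d < 2 * m)
    (hd : A d → D (lab d) = r + 1 → D (lab (rev d)) ≠ 0) :
    SearchState lab A s r (dartCode d + 1) D P where
  source := h.source
  eq_source := h.eq_source
  le := h.le
  scanned c hc h0 hr := by
    by_cases hcd : c = d
    · subst hcd
      rcases hr with hr | hr
      · exact h.scanned c hc h0 (Or.inl hr)
      · have := h.le _ (hlab (rev c))
        exact ⟨hd hc hr.1, by omega⟩
    · have : dartCode c ≠ dartCode d := fun he => hcd (dartCode_injective he)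
      exact h.scanned c hc h0 (by omega)
  pred := h.pred

theorem SearchState.visit {d : Fin m × Bool} (h : SearchState lab A s r (dartCode d) D P)
    (hA : A d) (hr : D (lab d) = r + 1) (h0 : D (lab (rev d)) = 0) :
    SearchState lab A s r (dartCode d + 1) (Function.update D (lab (rev d)) (r + 2))
      (Function.update P (lab (rev d)) (dartCode d)) := by
  have hne : ∀ x, D x ≠ 0 → Function.update D (lab (rev d)) (r + 2) x = D x := fun x hx =>
    Function.update_of_ne (fun he : x = lab (rev d) => hx (by rw [he, h0])) _ _
  -- The new value `r + 2` is larger than all values to which `scanned` refers, so the earlier facts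
  -- survive the update.
  have hold : ∀ x, Function.update D (lab (rev d)) (r + 2) x ≤ r + 1 →
      Function.update D (lab (rev d)) (r + 2) x = D x := by
    intro x hx
    by_cases hxd : x = lab (rev d)
    · subst hxd
      rw [Function.update_self] at hx
      omega
    · exact Function.update_of_ne hxd _ _
  have hle : ∀ x < 2 * m, Function.update D (lab (rev d)) (r + 2) x ≤ r + 2 := by
    intro x hx
    by_cases hxd : x = lab (rev d)
    · subst hxd
      rw [Function.update_self]
    · rw [Function.update_of_ne hxd]
      exact h.le x hx
  refine ⟨?_, ?_, hle, ?_, ?_⟩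
  · rw [hne _ (by rw [h.source]; exact one_ne_zero), h.source]
  · intro x hx h1
    exact h.eq_source x hx (by rw [← hold x (by omega), h1])
  · intro c hc hc0 hcr
    have hDc := hold (lab c) (by omega)
    rw [hDc] at hc0 hcr ⊢
    by_cases hcd : c = d
    · subst hcd
      rw [Function.update_self]
      omega
    · have hcode : dartCode c ≠ dartCode d := fun he => hcd (dartCode_injective he)
      have := h.scanned c hc hc0 (by omega)
      rwa [hne _ this.1]
  · intro x hx hx2
    by_cases hxd : x = lab (rev d)
    · subst hxd
      refine ⟨d, hA, Function.update_self _ _ _, rfl, ?_⟩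
      rw [Function.update_self, hne _ (by omega), hr]
    · rw [Function.update_of_ne hxd] at hx2
      obtain ⟨c, h1, h2, h3, h4⟩ := h.pred x hx hx2
      refine ⟨c, h1, by rw [Function.update_of_ne hxd, h2], h3, ?_⟩
      rw [Function.update_of_ne hxd, hne _ ?_, h4]
      intro hc0
      have := h.eq_source x hx
      omega

/-- The search from the face of the dart `2 e + 1`, where `e` is scalar `18`, through the darts of
kept edges other than `e`. The result is in the arrays `5` and `6`. -/
def scanDart : Prog :=
  .ite (.read 3 (.read 8 (var 16))) .nop
  -- The sum of the truncated differences in both directions is nonzero iff the two numbers differ.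
  (.ite (.add (.sub (.read 8 (var 16)) (var 18)) (.sub (var 18) (.read 8 (var 16))))
    (.ite (.add (.sub (.read 5 (.read 4 (var 16))) (.add (var 15) (.const 1)))
        (.sub (.add (var 15) (.const 1)) (.read 5 (.read 4 (var 16))))) .nop
      (.ite (.read 5 (.read 4 (.read 7 (var 16)))) .nop
        (.seq (.write 6 (.read 4 (.read 7 (var 16))) (var 16))
          (.write 5 (.read 4 (.read 7 (var 16))) (.add (var 15) (.const 2))))))
    .nop)

def search : Prog :=
  .seq (forLoop 10 numDarts (.write 5 (var 10) (.const 0)))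
  (.seq (.write 5 (.read 4 (.add (.add (var 18) (var 18)) (.const 1))) (.const 1))
    (forLoop 15 numEdges (forLoop 16 numDarts scanDart)))

theorem runs_scanDart (M : EmbeddedGraph (Fin n) (Fin m)) (μ : Store) (hμ : Tables M μ)
    (hlab : ∀ d : Fin m × Bool, μ 4 (dartCode d) < 2 * m) (e : Fin m) (h18 : μ 18 0 = e)
    (d : Fin m × Bool) (h16 : μ 16 0 = dartCode d) {s : ℕ}
    (h : SearchState (fun d => μ 4 (dartCode d)) (fun d => d.1 ∈ keptEdges m μ ∧ d.1 ≠ e) s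
      (μ 15 0) (dartCode d) (μ 5) (μ 6)) :
    Runs scanDart μ 80 fun μ' => SearchState (fun d => μ 4 (dartCode d))
      (fun d => d.1 ∈ keptEdges m μ ∧ d.1 ≠ e) s (μ 15 0) (dartCode d + 1) (μ' 5) (μ' 6) := by
  have hnop : ∀ {T}, 1 ≤ T → (d.1 ∈ keptEdges m μ ∧ d.1 ≠ e → μ 5 (μ 4 (dartCode d)) = μ 15 0 + 1 →
      μ 5 (μ 4 (dartCode (rev d))) ≠ 0) →
      Runs .nop μ T fun μ' => SearchState (fun d => μ 4 (dartCode d))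
        (fun d => d.1 ∈ keptEdges m μ ∧ d.1 ≠ e) s (μ 15 0) (dartCode d + 1) (μ' 5) (μ' 6) :=
    fun hT hd => Runs.of_run rfl hT (h.skip hlab hd)
  refine (Runs.ite (T := 70) (fun h1 => hnop (by omega) ?_) fun h1 => (Runs.ite (T := 50)
    (fun h2 => (Runs.ite (T := 30) (fun h3 => hnop (by omega) ?_) fun h3 => (Runs.ite (T := 20)
      (fun h4 => hnop (by omega) ?_) fun h4 => Runs.of_run rfl (by decide) ?_).mono
        (by decide) fun _ _ h => h).mono
      (by decide) fun _ _ h => h) fun h2 => hnop (by omega) ?_).mono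
    (by decide) fun _ _ h => h).mono (by decide) fun _ _ h => h
  all_goals simp only [Expr.eval, h16, hμ.edge] at h1
  · exact fun hd => absurd (mem_keptEdges.1 hd.1) h1
  all_goals simp only [Expr.eval, h16, hμ.edge, h18] at h2
  · simp only [Expr.eval, h16] at h3
    intro _ h5
    omega
  · simp only [Expr.eval, h16, hμ.rev] at h4
    exact fun _ _ => h4
  · simp only [Expr.eval, h16, hμ.rev] at h3 h4
    have hv := h.visit ⟨mem_keptEdges.2 h1, fun he => h2 (by rw [he]; omega)⟩
      (by omega : μ 5 (μ 4 (dartCode d)) = μ 15 0 + 1) h4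
    convert hv using 1
    · funext x
      simp [Prog.run, Expr.eval, Store.set, h16, hμ.rev, Function.update_apply]
    · funext x
      simp [Prog.run, Expr.eval, Store.set, h16, hμ.rev, Function.update_apply]
  · exact fun hd => absurd (Fin.ext (by omega)) hd.2

/-- `m` rounds are enough: dual cycles have distinct edges, so only lengths up to `m` matter. -/
theorem runs_search (M : EmbeddedGraph (Fin n) (Fin m)) (μ : Store) (hμ : Tables M μ)
    (hlab : ∀ d : Fin m × Bool, μ 4 (dartCode d) < 2 * m) (e : Fin m) (h18 : μ 18 0 = e) :
    Runs search μ (m * (2 * m * 100 + 80) + 40) fun μ' =>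
      SearchState (fun d => μ 4 (dartCode d)) (fun d => d.1 ∈ keptEdges m μ ∧ d.1 ≠ e)
        (μ 4 (dartCode (e, true))) m 0 (μ' 5) (μ' 6) := by
  have hsize : ∀ μ' : Store, μ' 0 = μ 0 → numDarts.eval μ' = 2 * m := by
    intro μ' h
    simp only [Expr.eval]
    rw [h, hμ.size]
    omega
  refine (Runs.seq (Runs.forLoop (T := 4) (N := 2 * m) (fun j μ' => ∀ x < j, μ' 5 x = 0) (by decide)
    (fun μ' hf => hsize μ' (hf 0 (by decide) (by decide))) (by simp) ?_) fun μ₁ hf₁ h₁ =>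
    Runs.seq_run rfl (Runs.forLoop (T := 2 * m * 95 + 12) (N := m)
      (fun r μ' => SearchState (fun d => μ 4 (dartCode d)) (fun d => d.1 ∈ keptEdges m μ ∧ d.1 ≠ e)
        (μ 4 (dartCode (e, true))) r 0 (μ' 5) (μ' 6)) (by decide) ?_ ?_ ?_)).mono
    ?_ fun _ _ h => h
  · intro j _ μ' _ h10 h
    refine Runs.of_run rfl (by decide) fun x hx => ?_
    simp only [Prog.run, Expr.eval, Store.set, h10]
    rcases Nat.lt_succ_iff_lt_or_eq.1 hx with hx | rfl
    · simp [h x hx]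
    · simp
  · intro μ' hf
    simp only [Expr.eval]
    rw [hf 0 (by decide) (by decide)]
    simp only [Prog.run]
    rw [Store.set_of_ne _ _ _ (by decide), hf₁ 0 (by decide), hμ.size]
  · have hsrc : μ₁ 4 (μ₁ 18 0 + μ₁ 18 0 + 1) = μ 4 (dartCode (e, true)) := by
      rw [hf₁ 4 (by decide), hf₁ 18 (by decide), h18, dartCode_true]
    have h5 : ∀ x, ((Prog.write 5 (.read 4 (.add (.add (var 18) (var 18)) (.const 1)))
        (.const 1)).run μ₁).set 15 0 0 5 x =
        if x = μ 4 (dartCode (e, true)) then 1 else μ₁ 5 x := by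
      intro x
      simp [Prog.run, Expr.eval, Store.set, hsrc]
    refine ⟨?_, ?_, ?_, ?_, ?_⟩
    · rw [h5, if_pos rfl]
    · intro x hx hx1
      by_contra hne
      rw [h5, if_neg hne, h₁ x hx] at hx1
      exact absurd hx1 zero_ne_one
    · intro x hx
      rw [h5]
      split_ifs
      · omega
      · rw [h₁ x hx]
        omega
    · intro d _ h0 h0'
      omega
    · intro x hx hx2
      rw [h5] at hx2
      split_ifs at hx2
      · omega
      · rw [h₁ x hx] at hx2
        omega
  · intro r hr μ₂ hf₂ h15 h
    have hf₃ : ∀ b ∉ [5, 6, 10, 15, 16], μ₂ b = μ b := by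
      intro b hb
      simp only [List.mem_cons, List.not_mem_nil, or_false, not_or] at hb
      rw [hf₂ b (by tauto) (by simp [scanDart, forLoop, Prog.writes]; tauto)]
      simp only [Prog.run]
      rw [Store.set_of_ne _ _ _ (by tauto), hf₁ b (by simp [forLoop, Prog.writes]; tauto)]
    refine (Runs.forLoop (T := 80) (N := 2 * m)
      (fun j μ' => SearchState (fun d => μ 4 (dartCode d)) (fun d => d.1 ∈ keptEdges m μ ∧ d.1 ≠ e)
        (μ 4 (dartCode (e, true))) r j (μ' 5) (μ' 6)) (by decide) ?_ ?_ ?_).mono ?_ ?_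
    · intro μ' hf
      refine hsize μ' ?_
      rw [hf 0 (by decide) (by decide), hf₃ 0 (by decide)]
    · exact h
    · intro j hj μ₃ hf₄ h16 h'
      obtain ⟨d, rfl⟩ : ∃ d : Fin m × Bool, dartCode d = j := ⟨_, dartCode_dartOfCode j hj⟩
      have hf₅ : ∀ b ∉ [5, 6, 10, 15, 16], μ₃ b = μ b := by
        intro b hb
        rw [← hf₃ b hb]
        simp only [List.mem_cons, List.not_mem_nil, or_false, not_or] at hb
        exact hf₄ b (by tauto) (by simp [scanDart, Prog.writes]; tauto)
      have h15' : μ₃ 15 0 = r := by rw [hf₄ 15 (by decide) (by decide), h15]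
      have hrun := runs_scanDart M μ₃ (s := μ 4 (dartCode (e, true))) (hμ.congr (hf₅ 0 (by decide))
        (hf₅ 2 (by decide)) (hf₅ 7 (by decide)) (hf₅ 8 (by decide)))
        (by rw [hf₅ 4 (by decide)]; exact hlab) e (by rw [hf₅ 18 (by decide), h18]) d h16
      rw [h15', hf₅ 4 (by decide), keptEdges_congr (hf₅ 3 (by decide))] at hrun
      exact hrun h'
    · simp only [Expr.cost]
      omega
    · exact fun μ' _ h => h.nextRound
  · simp only [Prog.time, Expr.cost]
    rw [Nat.mul_add, Nat.mul_add, Nat.mul_add]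
    nlinarith

end RAM

namespace RAM

open EmbeddedGraph

variable {n m : ℕ}

/-! ### Cycles found by the search -/

/-- Darts that follow each other around a cycle of faces form a cycle of the dual. -/
theorem isCycle_of_darts (M : EmbeddedGraph (Fin n) (Fin m)) {S : Set (Fin m)} {f : ℕ → ℕ}
    (hf : IsLabeling M S f) (ℓ : ℕ) (d : ℕ → Fin m × Bool) (hS : ∀ i ≤ ℓ, (d i).1 ∈ S)
    (hlink : ∀ i < ℓ, f (dartCode (rev (d i))) = f (dartCode (d (i + 1))))
    (hclose : f (dartCode (rev (d ℓ))) = f (dartCode (d 0)))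
    (hface : ∀ i ≤ ℓ, ∀ j ≤ ℓ, f (dartCode (d i)) = f (dartCode (d j)) → i = j)
    (hedge : ∀ i ≤ ℓ, ∀ j ≤ ℓ, (d i).1 = (d j).1 → i = j) :
    ∃ (v : Fin (ℓ + 1) → (M.keep S).Face) (e : Fin (ℓ + 1) → S),
      (M.keep S).dual.IsCycle v e ∧ ∀ i, (e i : Fin m) = (d i).1 := by
  let e : Fin (ℓ + 1) → S := fun i => ⟨(d i).1, hS i (Nat.lt_succ_iff.1 i.2)⟩
  refine ⟨fun i => (M.keep S).faceOf (e i, (d i).2), e, ⟨ℓ.succ_pos, ?_, ?_, ?_⟩, fun i => rfl⟩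
  · intro i j hij
    rw [keep_faceOf_eq_iff, ← hf.eq_iff] at hij
    exact Fin.ext (hface i (Nat.lt_succ_iff.1 i.2) j (Nat.lt_succ_iff.1 j.2) hij)
  · intro i j hij
    exact Fin.ext (hedge i (Nat.lt_succ_iff.1 i.2) j (Nat.lt_succ_iff.1 j.2)
      (congrArg Subtype.val hij))
  · intro i
    refine ⟨(d i).2, rfl, ?_⟩
    rw [keep_faceOf_eq_iff, ← hf.eq_iff]
    obtain ⟨i, hi⟩ := i
    rcases Nat.lt_succ_iff_lt_or_eq.1 hi with hlt | rfl
    · rw [finRotate_of_lt hlt]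
      exact hlink i hlt
    · rw [finRotate_last']
      exact hclose

/-- Predecessors are followed back from the face of `(e, false)`. As `D` drops by one each time, the
faces are distinct and after `ℓ` steps the source is reached, which is the face of `(e, true)`; the
edge `e` closes the path. For `ℓ = 0` the cycle is a loop. Thus the value of `D` at the start is the
length of the cycle. -/
theorem SearchState.exists_isCycle {M : EmbeddedGraph (Fin n) (Fin m)} {S : Set (Fin m)}
    {f D P : ℕ → ℕ} (hf : IsLabeling M S f) {e : Fin m} (he : e ∈ S) {r j : ℕ}
    (h : SearchState (fun d => f (dartCode d)) (fun d => d.1 ∈ S ∧ d.1 ≠ e)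
      (f (dartCode (e, true))) r j D P) {ℓ : ℕ} (hℓ : D (f (dartCode (e, false))) = ℓ + 1) :
    ∃ (x : ℕ → ℕ) (c : ℕ → Fin m × Bool), x 0 = f (dartCode (e, false)) ∧
      (∀ i < ℓ, P (x i) = dartCode (c i) ∧ f (dartCode (c i)) = x (i + 1)) ∧
      (∀ i ≤ ℓ, D (x i) = ℓ + 1 - i) ∧
      ∃ (v : Fin (ℓ + 1) → (M.keep S).Face) (e' : Fin (ℓ + 1) → S),
        (M.keep S).dual.IsCycle v e' ∧
        ∀ a, a ∈ Set.range (fun i => (e' i : Fin m)) ↔ a = e ∨ ∃ i < ℓ, (c i).1 = a := by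
  -- A dummy dart makes the predecessor a total function, so that it can be iterated.
  have hpred : ∀ y, ∃ d : Fin m × Bool, y < 2 * m → 2 ≤ D y → (d.1 ∈ S ∧ d.1 ≠ e) ∧
      P y = dartCode d ∧ f (dartCode (rev d)) = y ∧ D (f (dartCode d)) + 1 = D y := by
    intro y
    by_cases hy : y < 2 * m ∧ 2 ≤ D y
    · obtain ⟨d, hd⟩ := h.pred y hy.1 hy.2
      exact ⟨d, fun _ _ => hd⟩
    · exact ⟨(e, true), fun h1 h2 => absurd ⟨h1, h2⟩ hy⟩
  choose g hg using hpred
  let x : ℕ → ℕ := fun i => (fun y => f (dartCode (g y)))^[i] (f (dartCode (e, false)))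
  have hx_succ : ∀ i, x (i + 1) = f (dartCode (g (x i))) := fun i =>
    Function.iterate_succ_apply' _ _ _
  have hx_lt : ∀ i, x i < 2 * m := by
    intro i
    cases i with
    | zero => exact hf.lt _
    | succ i => rw [hx_succ]; exact hf.lt _
  have hD : ∀ i ≤ ℓ, D (x i) = ℓ + 1 - i := by
    intro i
    induction i with
    | zero => exact fun _ => hℓ
    | succ i ih =>
      intro hi
      have hi' := ih (by omega)
      have := (hg (x i) (hx_lt i) (by omega)).2.2.2
      rw [hx_succ]
      omega
  have hgx : ∀ i < ℓ, ((g (x i)).1 ∈ S ∧ (g (x i)).1 ≠ e) ∧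
      P (x i) = dartCode (g (x i)) ∧ f (dartCode (rev (g (x i)))) = x i ∧
        D (f (dartCode (g (x i)))) + 1 = D (x i) := fun i hi =>
    hg _ (hx_lt i) (by have := hD i (by omega); omega)
  have hxℓ : x ℓ = f (dartCode (e, true)) := h.eq_source _ (hx_lt ℓ) (by
    have := hD ℓ le_rfl
    omega)
  have hinj : ∀ i ≤ ℓ, ∀ j ≤ ℓ, x i = x j → i = j := by
    intro i hi j hj hij
    have h1 := hD i hi
    have h2 := hD j hj
    rw [hij] at h1
    omega
  refine ⟨x, fun i => g (x i), rfl, fun i hi => ⟨(hgx i hi).2.1, (hx_succ i).symm⟩, hD, ?_⟩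
  let d : ℕ → Fin m × Bool := fun i => if i < ℓ then rev (g (x i)) else (e, true)
  have hd_lt : ∀ i, i < ℓ → d i = rev (g (x i)) := fun i hi => if_pos hi
  have hd_eq : d ℓ = (e, true) := if_neg (lt_irrefl ℓ)
  have hdx : ∀ i ≤ ℓ, f (dartCode (d i)) = x i := by
    intro i hi
    rcases hi.lt_or_eq with hi | rfl
    · rw [hd_lt i hi, (hgx i hi).2.2.1]
    · rw [hd_eq, hxℓ]
  have hedge : ∀ j ≤ ℓ, ∀ i < j, (d i).1 ≠ (d j).1 := by
    intro j hj i hi hij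
    rw [hd_lt i (by omega)] at hij
    rcases hj.lt_or_eq with hj | rfl
    · rw [hd_lt j hj] at hij
      rcases eq_or_eq_rev hij with h' | h'
      · have h1 := hdx i (by omega)
        have h2 := hdx j (by omega)
        rw [hd_lt i (by omega), h', ← hd_lt j hj, h2] at h1
        have := hinj j (by omega) i (by omega) h1
        omega
      -- An edge used in both directions would give `x (j + 1) = x i` with `i < j`.
      · have h1 := hdx i (by omega)
        rw [hd_lt i (by omega), h', rev_rev, ← hx_succ] at h1
        have := hinj (j + 1) (by omega) i (by omega) h1
        omega
    · rw [hd_eq] at hij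
      exact (hgx i hi).1.2 hij
  have hS : ∀ i ≤ ℓ, (d i).1 ∈ S := by
    intro i hi
    rcases hi.lt_or_eq with hi | rfl
    · rw [hd_lt i hi]
      exact (hgx i hi).1.1
    · rwa [hd_eq]
  have hlink : ∀ i < ℓ, f (dartCode (rev (d i))) = f (dartCode (d (i + 1))) := by
    intro i hi
    rw [hd_lt i hi, rev_rev, hdx _ hi, hx_succ]
  have hclose : f (dartCode (rev (d ℓ))) = f (dartCode (d 0)) := by
    rw [hd_eq, hdx 0 (by omega)]
    rfl
  obtain ⟨v, e', hc, he'⟩ := isCycle_of_darts M hf ℓ d hS hlink hclose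
    (fun i hi j hj hij => hinj i hi j hj (by rwa [hdx i hi, hdx j hj] at hij))
    (fun i hi j hj hij => by
      rcases lt_trichotomy i j with hlt | heq | hlt
      · exact absurd hij (hedge j hj i hlt)
      · exact heq
      · exact absurd hij.symm (hedge i hi j hlt))
  refine ⟨v, e', hc, fun a => ⟨?_, ?_⟩⟩
  · rintro ⟨⟨i, hi⟩, rfl⟩
    rcases Nat.lt_succ_iff_lt_or_eq.1 hi with hi' | hi'
    · exact Or.inr ⟨i, hi', ((he' _).trans (by rw [hd_lt i hi', rev_fst])).symm⟩
    · exact Or.inl ((he' _).trans (by subst hi'; rw [hd_eq]))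
  · rintro (rfl | ⟨i, hi, rfl⟩)
    · exact ⟨Fin.last ℓ, (he' _).trans (by rw [Fin.val_last, hd_eq])⟩
    · exact ⟨⟨i, by omega⟩, (he' _).trans (by rw [hd_lt i hi, rev_fst])⟩

/-! ### Completeness of the search -/

theorem finRotate_pow_val (N j : ℕ) (i : Fin (N + 1)) :
    (((finRotate (N + 1)) ^ j) i : ℕ) = (i + j) % (N + 1) := by
  induction j with
  | zero => simp [Nat.mod_eq_of_lt i.2]
  | succ j ih =>
    rw [pow_succ', Equiv.Perm.mul_apply, finRotate_apply, Fin.val_add, ih, Fin.val_one',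
      ← Nat.add_mod, Nat.add_assoc]

theorem finRotate_pow_ne {N j : ℕ} (h0 : 0 < j) (hj : j < N + 1) (i : Fin (N + 1)) :
    ((finRotate (N + 1)) ^ j) i ≠ i := by
  intro h
  have h1 := congrArg Fin.val h
  rw [finRotate_pow_val] at h1
  have := i.2
  rcases Nat.lt_or_ge (i + j) (N + 1) with hlt | hge
  · rw [Nat.mod_eq_of_lt hlt] at h1
    omega
  · rw [Nat.mod_eq_sub_mod hge, Nat.mod_eq_of_lt (by omega)] at h1
    omega

theorem finRotate_pow_self (N : ℕ) (i : Fin (N + 1)) : ((finRotate (N + 1)) ^ (N + 1)) i = i :=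
  Fin.ext (by rw [finRotate_pow_val, Nat.add_mod_right, Nat.mod_eq_of_lt i.2])

/-- A dual cycle through `e`, as a closed walk of darts that starts with `(e, false)`. -/
theorem exists_closed_walk {M : EmbeddedGraph (Fin n) (Fin m)} {S : Set (Fin m)} {ℓ : ℕ}
    {v : Fin ℓ → (M.keep S).Face} {e' : Fin ℓ → S} (h : (M.keep S).dual.IsCycle v e')
    (i : Fin ℓ) : ∃ c : ℕ → Fin m × Bool, c 0 = ((e' i : Fin m), false) ∧ c ℓ = c 0 ∧
      (∀ j, (M.walkPerm S).SameCycle (rev (c j)) (c (j + 1))) ∧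
      ∀ j, 0 < j → j < ℓ → (c j).1 ∈ S ∧ (c j).1 ≠ e' i := by
  obtain ⟨d, hd, hlink⟩ := M.exists_darts_of_isCycle S h
  obtain ⟨N, rfl⟩ : ∃ N, ℓ = N + 1 := ⟨ℓ - 1, by have := h.pos; omega⟩
  set σ := finRotate (N + 1)
  have hmem : ∀ i, (d i).1 ∈ S := fun i => by rw [hd]; exact Subtype.coe_prop _
  have hne : ∀ i i', i' ≠ i → (d i').1 ≠ e' i := by
    intro i i' hi he
    rw [hd] at he
    exact hi (h.edge_injective (Subtype.ext he))
  have hfst : (d i).1 = ((e' i : Fin m), false).1 := hd i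
  rcases eq_or_eq_rev hfst with hdi | hdi
  · refine ⟨fun j => d ((σ ^ j) i), hdi, ?_, fun j => ?_, fun j h0 hj => ⟨hmem _, hne _ _ ?_⟩⟩
    · exact congrArg d (finRotate_pow_self N i)
    · have := hlink ((σ ^ j) i)
      rwa [← Equiv.Perm.mul_apply, ← pow_succ'] at this
    · exact finRotate_pow_ne h0 hj i
  -- The cycle passes through its edge as `(e, true)`, so it is traversed backwards.
  · refine ⟨fun j => rev (d ((σ⁻¹ ^ j) i)), ?_, ?_, fun j => ?_, fun j h0 hj =>
      ⟨hmem _, hne _ _ ?_⟩⟩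
    · change rev (d i) = _
      rw [hdi, rev_rev]
    · refine congrArg (fun i => rev (d i)) ?_
      rw [inv_pow, Equiv.Perm.inv_eq_iff_eq]
      exact (finRotate_pow_self N i).symm
    · have := hlink ((σ⁻¹ ^ (j + 1)) i)
      rw [pow_succ', Equiv.Perm.mul_apply, ← Equiv.Perm.mul_apply σ, mul_inv_cancel,
        Equiv.Perm.one_apply] at this
      change (M.walkPerm S).SameCycle (rev (rev _)) (rev (d ((σ⁻¹ ^ (j + 1)) i)))
      rw [rev_rev, pow_succ', Equiv.Perm.mul_apply]
      exact this.symm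
    · rw [inv_pow, Ne, Equiv.Perm.inv_eq_iff_eq]
      exact fun he => finRotate_pow_ne h0 hj i he.symm

/-- The rest of the cycle is a walk without `e` from the face of `(e, true)`, where `D` is 1, to the
face of `(e, false)`; along each of its darts `D` grows by at most one. -/
theorem SearchState.le_of_isCycle {M : EmbeddedGraph (Fin n) (Fin m)} {S : Set (Fin m)}
    {f D P : ℕ → ℕ} (hf : IsLabeling M S f) {e : Fin m}
    (h : SearchState (fun d => f (dartCode d)) (fun d => d.1 ∈ S ∧ d.1 ≠ e)
      (f (dartCode (e, true))) m 0 D P) {ℓ : ℕ} {v : Fin ℓ → (M.keep S).Face} {e' : Fin ℓ → S}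
    (hc : (M.keep S).dual.IsCycle v e') (i : Fin ℓ) (hi : (e' i : Fin m) = e) (hℓ : ℓ ≤ m) :
    D (f (dartCode (e, false))) ≠ 0 ∧ D (f (dartCode (e, false))) ≤ ℓ := by
  obtain ⟨c, hc0, hcℓ, hlink, hmem⟩ := exists_closed_walk hc i
  rw [hi] at hc0 hmem
  have key : ∀ j < ℓ, D (f (dartCode (c (j + 1)))) ≠ 0 ∧ D (f (dartCode (c (j + 1)))) ≤ j + 1 := by
    intro j
    induction j with
    | zero =>
      intro _
      have h1 := (hf.eq_iff _ _).2 (hlink 0)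
      rw [hc0] at h1
      have h2 : D (f (dartCode (e, true))) = 1 := h.source
      rw [zero_add, ← h1]
      change D (f (dartCode (e, true))) ≠ 0 ∧ D (f (dartCode (e, true))) ≤ 1
      omega
    | succ j ih =>
      intro hj
      obtain ⟨h1, h2⟩ := ih (by omega)
      -- Since `j + 1 < ℓ ≤ m`, this face is in the range where all darts have been scanned.
      have h3 := h.scanned (c (j + 1)) (hmem _ (by omega) hj) h1 (Or.inl (by omega))
      rw [← (hf.eq_iff _ _).2 (hlink (j + 1))]
      exact ⟨h3.1, by omega⟩
  have hpos := hc.pos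
  have := key (ℓ - 1) (by omega)
  rwa [Nat.sub_add_cancel hpos, hcℓ, hc0] at this

end RAM

namespace RAM

open EmbeddedGraph

variable {n m : ℕ}

/-! ### The algorithm -/

/-- Delete the edge in scalar `18` and the edges of the path found by the search. -/
def deleteCycle : Prog :=
  .seq (.seq (.write 3 (var 18) (.const 1)) (assign 11 (.read 4 (.add (var 18) (var 18)))))
  (.seq (.loop (.sub (.read 5 (var 11)) (.const 1))
    (.seq (.write 3 (.read 8 (.read 6 (var 11))) (.const 1))
      (assign 11 (.read 4 (.read 6 (var 11))))))
  (assign 18 (.const 0)))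

def nextEdge : Prog := assign 18 (.add (var 18) (.const 1))

/-- Nonzero iff the search has found a cycle of length at most scalar `17`. -/
def cycleFound : Expr :=
  .sub (.const 1) (.add (.sub (.const 1) (.read 5 (.read 4 (.add (var 18) (var 18)))))
    (.sub (.read 5 (.read 4 (.add (var 18) (var 18)))) (var 17)))

def mainLoop : Prog :=
  .loop (.sub numEdges (var 18))
    (.ite (.read 3 (var 18)) nextEdge
      (.seq computeLabels (.seq search (.ite cycleFound deleteCycle nextEdge))))

/-- Delete short dual cycles as long as there are any. -/
def algorithm : Prog := .seq buildTables (.seq squareK (.seq maxLength mainLoop))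

/-- There is no dual cycle of length at most `T` through `e`. -/
def NoShortCycle (M : EmbeddedGraph (Fin n) (Fin m)) (S : Set (Fin m)) (T : ℕ) (e : Fin m) : Prop :=
  ∀ (ℓ : ℕ) (v : Fin ℓ → (M.keep S).Face) (e' : Fin ℓ → S), (M.keep S).dual.IsCycle v e' →
    (∃ i, (e' i : Fin m) = e) → T < ℓ

theorem length_le_of_isCycle {M : EmbeddedGraph (Fin n) (Fin m)} {S : Set (Fin m)} {ℓ : ℕ}
    {v : Fin ℓ → (M.keep S).Face} {e' : Fin ℓ → S} (h : (M.keep S).dual.IsCycle v e') : ℓ ≤ m := by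
  simpa using Fintype.card_le_of_injective (fun i => (e' i : Fin m))
    (Subtype.val_injective.comp h.edge_injective)

/-- The invariant of the main loop. -/
structure MainInv (M : EmbeddedGraph (Fin n) (Fin m)) (L : ℝ) (T : ℕ) (μ : Store) : Prop where
  tables : Tables M μ
  maxLength : μ 17 0 = T
  deletion : M.CycleDeletion L (keptEdges m μ)
  le : μ 18 0 ≤ m
  noShortCycle : ∀ e : Fin m, (e : ℕ) < μ 18 0 → e ∈ keptEdges m μ →
    NoShortCycle M (keptEdges m μ) T e

/-- `D` counts down along the path and equals 1 only at its end, where the loop stops. -/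
theorem runs_deleteCycle (M : EmbeddedGraph (Fin n) (Fin m)) (μ : Store) (hμ : Tables M μ)
    (e : Fin m) (h18 : μ 18 0 = e) (x : ℕ → ℕ) (c : ℕ → Fin m × Bool) (ℓ : ℕ)
    (hx0 : x 0 = μ 4 (dartCode (e, false)))
    (hc : ∀ i < ℓ, μ 6 (x i) = dartCode (c i) ∧ μ 4 (dartCode (c i)) = x (i + 1))
    (hD : ∀ i ≤ ℓ, μ 5 (x i) = ℓ + 1 - i) :
    Runs deleteCycle μ (ℓ * 20 + 40) fun μ' => μ' 18 0 = 0 ∧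
      ∀ a : Fin m, μ' 3 a = 0 ↔ μ 3 a = 0 ∧ ¬ (a = e ∨ ∃ i < ℓ, (c i).1 = a) := by
  refine (Runs.seq_run rfl (Runs.seq (Runs.loop (T := 14) (F := ℓ)
    (fun μ' => (∀ b ∉ [3, 11], μ' b = μ b) ∧ ∃ i ≤ ℓ, μ' 11 0 = x i ∧
      ∀ a : Fin m, μ' 3 a = 0 ↔ μ 3 a = 0 ∧ ¬ (a = e ∨ ∃ i' < i, (c i').1 = a))
    (fun μ' => μ' 5 (μ' 11 0) - 1) ?_ ?_ ?_) fun μ₁ hf₁ h₁ => Runs.of_run (T := 3) rfl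
      (by decide) ?_)).mono ?_ fun _ _ h => h
  · rintro μ' ⟨hf, i, hi, h11, h3⟩ hne
    simp only [Expr.eval] at hne
    have h5 := hD i hi
    rw [hf 5 (by decide), h11, h5] at hne
    have hlt : i < ℓ := by omega
    have h6 : μ' 6 (μ' 11 0) = dartCode (c i) := by
      rw [hf 6 (by decide), h11, (hc i hlt).1]
    have h8 : μ' 8 (dartCode (c i)) = (c i).1 := by
      rw [hf 8 (by decide), hμ.edge]
    have h4 : μ' 4 (dartCode (c i)) = x (i + 1) := by
      rw [hf 4 (by decide), (hc i hlt).2]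
    refine Runs.of_run (by decide) (by decide) ⟨⟨fun b hb => ?_, i + 1, hlt, ?_, fun a => ?_⟩, ?_⟩
    · rw [← hf b hb]
      simp only [List.mem_cons, List.not_mem_nil, or_false, not_or] at hb
      simp only [Prog.run]
      rw [Store.set_of_ne _ _ _ hb.2, Store.set_of_ne _ _ _ hb.1]
    · simp [Prog.run, Expr.eval, Store.set, h6, h4]
    · have : (Prog.run (.seq (.write 3 (.read 8 (.read 6 (var 11))) (.const 1))
          (assign 11 (.read 4 (.read 6 (var 11))))) μ') 3 a =
          if (a : ℕ) = (c i).1 then 1 else μ' 3 a := by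
        simp [Prog.run, Expr.eval, Store.set, h6, h8]
      rw [this]
      by_cases ha : (c i).1 = a
      · rw [if_pos (by rw [ha])]
        exact ⟨fun h => absurd h one_ne_zero, fun h => absurd (Or.inr ⟨i, by omega, ha⟩) h.2⟩
      · rw [if_neg (fun he => ha (Fin.ext he.symm)), h3]
        refine and_congr_right fun _ => not_congr (or_congr_right ⟨?_, ?_⟩)
        · rintro ⟨i', hi', h⟩
          exact ⟨i', by omega, h⟩
        · rintro ⟨i', hi', h⟩
          rcases Nat.lt_succ_iff_lt_or_eq.1 hi' with hi' | rfl
          · exact ⟨i', hi', h⟩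
          · exact absurd h ha
    · have h5' : μ' 5 (x (i + 1)) = ℓ + 1 - (i + 1) := by
        rw [hf 5 (by decide), hD _ hlt]
      have h5'' : μ' 5 (μ' 11 0) = ℓ + 1 - i := by
        rw [hf 5 (by decide), h11, h5]
      rw [h5'']
      simp [Prog.run, Expr.eval, Store.set, h6, h4, h5']
      omega
  · have h5 := hD 0 (by omega)
    rw [hx0, dartCode_false] at h5
    simp [Prog.run, Expr.eval, Store.set, h18, h5]
  · refine ⟨fun b hb => ?_, 0, Nat.zero_le _, ?_, fun a => ?_⟩
    · simp only [List.mem_cons, List.not_mem_nil, or_false, not_or] at hb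
      simp only [Prog.run]
      rw [Store.set_of_ne _ _ _ hb.2, Store.set_of_ne _ _ _ hb.1]
    · rw [hx0, dartCode_false]
      simp [Prog.run, Expr.eval, Store.set, h18]
    · by_cases ha : a = e
      · subst ha
        simp [Prog.run, Expr.eval, Store.set, h18]
      · have ha' : (a : ℕ) ≠ e := fun h => ha (Fin.ext h)
        simp [Prog.run, Expr.eval, Store.set, h18, ha, ha']
  · obtain ⟨⟨hf, i, hi, h11, h3⟩, h0⟩ := h₁
    simp only [Expr.eval] at h0
    rw [hf 5 (by decide), h11, hD i hi] at h0
    obtain rfl : i = ℓ := by omega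
    refine ⟨by simp [Prog.run, Expr.eval, Store.set], fun a => ?_⟩
    rw [← h3]
    simp [Prog.run, Store.set]
  · simp only [Prog.time, Expr.cost]
    omega

/-- A bound for the time of one iteration of the main loop. -/
def iterationTime (m : ℕ) : ℕ :=
  (2 * m * (2 * m * 41 + 50) + 12) + ((m * (2 * m * 100 + 80) + 40) + (m * 20 + 100)) + 10

/-- Either the counter advances or an edge is deleted; the weight `m + 1` of an edge outweighs the
reset of the counter. The reset is needed because a deletion can merge faces and so create short
cycles through edges examined before. -/
theorem runs_iteration (M : EmbeddedGraph (Fin n) (Fin m)) (L : ℝ) (T : ℕ) (hTm : T ≤ m)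
    (hT : ∀ ℓ ≤ T, (ℓ : ℝ) < L) (μ : Store) (h : MainInv M L T μ) (hlt : μ 18 0 < m) :
    Runs (.ite (.read 3 (var 18)) nextEdge
      (.seq computeLabels (.seq search (.ite cycleFound deleteCycle nextEdge)))) μ
      (iterationTime m) fun μ' => MainInv M L T μ' ∧
        (keptEdges m μ').ncard * (m + 1) + (m - μ' 18 0) <
          (keptEdges m μ).ncard * (m + 1) + (m - μ 18 0) := by
  obtain ⟨e, he⟩ : ∃ e : Fin m, μ 18 0 = e := ⟨⟨_, hlt⟩, rfl⟩
  have hnext : ∀ μ₁ : Store, (∀ b ∈ [0, 2, 3, 7, 8, 17, 18], μ₁ b = μ b) →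
      (e ∈ keptEdges m μ → NoShortCycle M (keptEdges m μ) T e) →
      Runs nextEdge μ₁ 6 fun μ' => MainInv M L T μ' ∧
        (keptEdges m μ').ncard * (m + 1) + (m - μ' 18 0) <
          (keptEdges m μ).ncard * (m + 1) + (m - μ 18 0) := by
    intro μ₁ hf hshort
    have hrun : nextEdge.run μ₁ = μ₁.set 18 0 (μ 18 0 + 1) := by
      simp [nextEdge, Prog.run, Expr.eval, hf 18 (by decide)]
    refine Runs.of_run rfl (by decide) ?_
    rw [hrun]
    have h18 : μ₁.set 18 0 (μ 18 0 + 1) 18 0 = μ 18 0 + 1 := by simp [Store.set]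
    have hf' : ∀ b ∈ [0, 2, 3, 7, 8, 17], μ₁.set 18 0 (μ 18 0 + 1) b = μ b := by
      intro b hb
      rw [Store.set_of_ne _ _ _ (by rintro rfl; simp at hb), hf b (by simp at hb ⊢; tauto)]
    have hS : keptEdges m (μ₁.set 18 0 (μ 18 0 + 1)) = keptEdges m μ :=
      keptEdges_congr (hf' 3 (by decide))
    rw [h18, hS]
    refine ⟨⟨h.tables.congr (hf' 0 (by decide)) (hf' 2 (by decide)) (hf' 7 (by decide))
      (hf' 8 (by decide)), ?_, ?_, ?_, ?_⟩, by omega⟩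
    · rw [hf' 17 (by decide), h.maxLength]
    · rw [hS]; exact h.deletion
    · rw [h18]; exact hlt
    · rw [h18, hS]
      intro a ha haS
      rcases Nat.lt_succ_iff_lt_or_eq.1 ha with ha | ha
      · exact h.noShortCycle a ha haS
      · obtain rfl : a = e := Fin.ext (by omega)
        exact hshort haS
  have hout : ∀ (P : Prog) (μ' : Store), (∀ b ∉ P.writes, μ' b = μ b) →
      (∀ b ∈ [0, 2, 3, 7, 8, 17, 18], b ∉ P.writes) →
      ∀ b ∈ [0, 2, 3, 7, 8, 17, 18], μ' b = μ b := fun P μ' h1 h2 b hb => h1 b (h2 b hb)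
  refine (Runs.ite (T := (2 * m * (2 * m * 41 + 50) + 12) + ((m * (2 * m * 100 + 80) + 40) +
    (m * 20 + 100))) (fun h3 => ?_) fun h3 => ?_).mono ?_ fun _ _ h => h
  · refine (hnext μ (fun _ _ => rfl) fun hS => absurd (mem_keptEdges.1 hS) ?_).mono (by omega)
      fun _ _ h => h
    rw [← he]
    exact h3
  · have heS : e ∈ keptEdges m μ := mem_keptEdges.2 (by rw [← he]; exact h3)
    refine Runs.seq (runs_computeLabels M μ h.tables) fun μ₁ hf₁ hlab => ?_
    have hf₁' := hout _ _ hf₁ (by decide)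
    have ht₁ : Tables M μ₁ := h.tables.congr (hf₁' 0 (by decide)) (hf₁' 2 (by decide))
      (hf₁' 7 (by decide)) (hf₁' 8 (by decide))
    have hS₁ : keptEdges m μ₁ = keptEdges m μ := keptEdges_congr (hf₁' 3 (by decide))
    refine Runs.seq (runs_search M μ₁ ht₁ hlab.lt e
      (by rw [hf₁' 18 (by decide), he])) fun μ₂ hf₂ hs => ?_
    rw [hS₁] at hs
    have hf₂' : ∀ b ∈ [0, 2, 3, 7, 8, 17, 18], μ₂ b = μ b := fun b hb => by
      rw [← hf₁' b hb]
      have hw : ∀ b ∈ [0, 2, 3, 7, 8, 17, 18], b ∉ search.writes := by decide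
      exact hf₂ b (hw b hb)
    have h4 : μ₂ 4 = μ₁ 4 := hf₂ 4 (by decide)
    have he₂ : μ₂ 18 0 = e := by rw [hf₂' 18 (by decide), he]
    have hfound : cycleFound.eval μ₂ = 1 - ((1 - μ₂ 5 (μ₁ 4 (dartCode (e, false)))) +
        (μ₂ 5 (μ₁ 4 (dartCode (e, false))) - T)) := by
      simp only [cycleFound, Expr.eval, he₂, h4, dartCode_false]
      rw [hf₂' 17 (by decide), h.maxLength]
    refine (Runs.ite (T := m * 20 + 60) (fun hc => ?_) fun hc => ?_).mono ?_ fun _ _ h => h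
    -- The test gives `1 ≤ D ≤ T` at the face of `(e, false)`, and this value is the length of the
    -- cycle found.
    · rw [hfound] at hc
      obtain ⟨ℓ, hℓ⟩ : ∃ ℓ, μ₂ 5 (μ₁ 4 (dartCode (e, false))) = ℓ + 1 :=
        ⟨μ₂ 5 (μ₁ 4 (dartCode (e, false))) - 1, by omega⟩
      obtain ⟨x, c, hx0, hxc, hD, v, e', hcyc, hrange⟩ := hs.exists_isCycle hlab heS hℓ
      have ht₂ : Tables M μ₂ := h.tables.congr (hf₂' 0 (by decide)) (hf₂' 2 (by decide))
        (hf₂' 7 (by decide)) (hf₂' 8 (by decide))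
      refine (runs_deleteCycle M μ₂ ht₂ e he₂ x c ℓ (by rw [h4, hx0])
        (fun i hi => by rw [h4]; exact hxc i hi) hD).mono (by omega) ?_
      rintro μ₃ hf₃ ⟨h18, h3'⟩
      have hS₃ : keptEdges m μ₃ = keptEdges m μ \ Set.range fun i => (e' i : Fin m) := by
        ext a
        rw [mem_keptEdges, h3', Set.mem_sdiff, hrange, mem_keptEdges, hf₂' 3 (by decide)]
      have hdel : M.CycleDeletion L (keptEdges m μ₃) := by
        rw [hS₃]
        exact CycleDeletion.delete _ (ℓ + 1) v e' h.deletion hcyc (hT _ (by omega))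
      refine ⟨⟨ht₂.congr (hf₃ 0 (by decide)) (hf₃ 2 (by decide)) (hf₃ 7 (by decide))
        (hf₃ 8 (by decide)), ?_, hdel, by omega, fun a ha => by omega⟩, ?_⟩
      · rw [hf₃ 17 (by decide), hf₂' 17 (by decide), h.maxLength]
      · have hcard : (keptEdges m μ₃).ncard < (keptEdges m μ).ncard := by
          refine Set.ncard_lt_ncard ⟨by rw [hS₃]; exact Set.sdiff_subset, fun hsub => ?_⟩
            (Set.toFinite _)
          have hee := hsub heS
          rw [hS₃] at hee
          exact hee.2 ((hrange e).2 (Or.inl rfl))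
        have := Nat.mul_le_mul_right (m + 1) (Nat.succ_le_of_lt hcard)
        rw [Nat.succ_mul] at this
        omega
    -- Here that value is 0 or exceeds `T`, whereas a cycle of length at most `T` would make it
    -- positive and at most `T`.
    · rw [hfound] at hc
      refine (hnext μ₂ hf₂' fun _ ℓ v e' hcyc hi => ?_).mono (by omega) fun _ _ h => h
      obtain ⟨i, hi⟩ := hi
      have := hs.le_of_isCycle hlab hcyc i hi (length_le_of_isCycle hcyc)
      omega
    · simp only [cycleFound, Expr.cost]
      omega
  · simp only [Expr.cost, iterationTime]
    omega

theorem runs_mainLoop (M : EmbeddedGraph (Fin n) (Fin m)) (L : ℝ) (T : ℕ) (hTm : T ≤ m)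
    (hT : ∀ ℓ ≤ T, (ℓ : ℝ) < L) (μ : Store) (h : MainInv M L T μ) :
    Runs mainLoop μ ((m * (m + 1) + m) * (6 + iterationTime m) + 6) fun μ' =>
      M.CycleDeletion L (keptEdges m μ') ∧
        ∀ e ∈ keptEdges m μ', NoShortCycle M (keptEdges m μ') T e := by
  refine (Runs.loop (T := iterationTime m) (F := m * (m + 1) + m) (MainInv M L T)
    (fun μ' => (keptEdges m μ').ncard * (m + 1) + (m - μ' 18 0)) ?_ ?_ h).mono le_rfl ?_
  · intro μ' h' hc
    simp only [Expr.eval, h'.tables.size] at hc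
    exact runs_iteration M L T hTm hT μ' h' (by omega)
  · have : (keptEdges m μ).ncard ≤ m := by
      simpa using Set.ncard_le_card (keptEdges m μ)
    have := Nat.mul_le_mul_right (m + 1) this
    omega
  · rintro μ' - ⟨h', hc⟩
    simp only [Expr.eval, h'.tables.size] at hc
    exact ⟨h'.deletion, fun e he => h'.noShortCycle e (by omega) he⟩

/-! ### The length threshold, correctness of the whole algorithm, and its polynomial time bound -/

theorem lt_div_iff_of_sq {k γ ℓ : ℕ} (hγ : 0 < γ) :
    9 * γ * ℓ ^ 2 < k * k ↔ (ℓ : ℝ) < (k : ℝ) / (3 * √(γ : ℝ)) := by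
  have hs : 0 < √(γ : ℝ) := Real.sqrt_pos.2 (by exact_mod_cast hγ)
  have hsq : ((ℓ : ℝ) * (3 * √(γ : ℝ))) ^ 2 = ((9 * γ * ℓ ^ 2 : ℕ) : ℝ) := by
    rw [mul_pow, mul_pow, Real.sq_sqrt (Nat.cast_nonneg γ)]
    push_cast
    ring
  rw [lt_div_iff₀ (by positivity), ← sq_lt_sq₀ (a := (ℓ : ℝ) * (3 * √(γ : ℝ))) (by positivity)
    (Nat.cast_nonneg k), hsq, sq (k : ℝ), ← Nat.cast_mul, Nat.cast_lt]

/-- A bound for the running time. -/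
def totalTime (m s : ℕ) : ℕ :=
  (m * 62 + 9) + ((s * 92 + 40) + ((m * 52 + 60) +
    ((m * (m + 1) + m) * (6 + iterationTime m) + 6)))

theorem runs_algorithm (M : EmbeddedGraph (Fin n) (Fin m)) {k γ : ℕ} (hk : 0 < k) (hγ : 0 < γ) :
    Runs algorithm (input M k γ) (totalTime m k.size) fun μ =>
      M.CycleDeletion ((k : ℝ) / (3 * √(γ : ℝ))) (keptEdges m μ) ∧
      ∀ (ℓ : ℕ) (v : Fin ℓ → (M.keep (keptEdges m μ)).Face) (e : Fin ℓ → keptEdges m μ),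
        (M.keep (keptEdges m μ)).dual.IsCycle v e → (k : ℝ) / (3 * √(γ : ℝ)) ≤ ℓ := by
  have hrot : ∀ d, input M k γ 2 (dartCode d) = dartCode (M.rot d) := fun d => by
    simp [input, dartCode_lt, dartOfCode_dartCode]
  refine Runs.seq (runs_buildTables M _ rfl hrot) fun μ₁ hf₁ h₁ => Runs.seq
    (runs_squareK μ₁ k (by rw [hf₁ 0 (by decide)]; rfl)) fun μ₂ hf₂ h₂ => Runs.seq
    (runs_maxLength μ₂ m k γ hk (by rw [hf₂ 0 (by decide), hf₁ 0 (by decide)]; rfl)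
      (by rw [hf₂ 0 (by decide), hf₁ 0 (by decide)]; rfl) h₂) fun μ₃ hf₃ h₃ => ?_
  have hS : keptEdges m μ₃ = Set.univ := by
    ext a
    rw [mem_keptEdges, hf₃ 3 (by decide), hf₂ 3 (by decide), hf₁ 3 (by decide)]
    simp [input]
  have h18 : μ₃ 18 0 = 0 := by
    rw [hf₃ 18 (by decide), hf₂ 18 (by decide), hf₁ 18 (by decide)]
    rfl
  have ht : Tables M μ₃ := (h₁.congr (hf₂ 0 (by decide)) (hf₂ 2 (by decide)) (hf₂ 7 (by decide))
    (hf₂ 8 (by decide))).congr (hf₃ 0 (by decide)) (hf₃ 2 (by decide)) (hf₃ 7 (by decide))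
    (hf₃ 8 (by decide))
  refine (runs_mainLoop M ((k : ℝ) / (3 * √(γ : ℝ))) (μ₃ 17 0) h₃.1
    (fun ℓ hℓ => (lt_div_iff_of_sq hγ).1 ((h₃.2 ℓ (hℓ.trans h₃.1)).1 hℓ)) μ₃
    ⟨ht, rfl, by rw [hS]; exact CycleDeletion.start, by omega, fun e he => by omega⟩).mono le_rfl ?_
  rintro μ₄ - ⟨h4, h5⟩
  refine ⟨h4, fun ℓ v e hc => ?_⟩
  have h6 := h5 _ (e ⟨0, hc.pos⟩).2 ℓ v e hc ⟨_, rfl⟩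
  by_contra! hlt
  -- The threshold is computed only among lengths up to `m`, which covers all dual cycles.
  have := (h₃.2 ℓ (length_le_of_isCycle hc)).2 ((lt_div_iff_of_sq hγ).2 hlt)
  omega

/-- `totalTime` as a polynomial. -/
noncomputable def timePolynomial : Polynomial ℕ :=
  let X : Polynomial ℕ := Polynomial.X
  (X * 62 + 9) + ((X * 92 + 40) + ((X * 52 + 60) + ((X * (X + 1) + X) *
    (6 + ((2 * X * (2 * X * 41 + 50) + 12) + ((X * (2 * X * 100 + 80) + 40) + (X * 20 + 100)) + 10))
      + 6)))

/-- The bound is monotone in both arguments, so each may be replaced by the input size. -/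
theorem totalTime_le (n m k γ : ℕ) :
    totalTime m k.size ≤ timePolynomial.eval (inputSize n m k γ) := by
  have hm : m ≤ inputSize n m k γ := by unfold inputSize; omega
  have hk : k.size ≤ inputSize n m k γ := by unfold inputSize; omega
  have : timePolynomial.eval (inputSize n m k γ) =
      totalTime (inputSize n m k γ) (inputSize n m k γ) := by
    simp [timePolynomial, totalTime, iterationTime]
  rw [this]
  unfold totalTime iterationTime
  gcongr

end RAM

/-- The girth lies in `ℕ∞`, so the real bound is first rounded up to a natural number. -/
theorem Graph.le_girth {α β : Type*} (G : Graph α β) (L : ℝ)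
    (h : ∀ (ℓ : ℕ) (v : Fin ℓ → α) (e : Fin ℓ → β), G.IsCycle v e → L ≤ ℓ) :
    ENNReal.ofReal L ≤ (G.girth : ℝ≥0∞) := by
  have h1 : ((⌈L⌉₊ : ℕ) : ℕ∞) ≤ G.girth :=
    le_iInf fun ℓ => le_iInf fun v => le_iInf fun e => le_iInf fun hc =>
      Nat.cast_le.2 (Nat.ceil_le.2 (h ℓ v e hc))
  calc ENNReal.ofReal L ≤ ((⌈L⌉₊ : ℕ) : ℝ≥0∞) := ENNReal.ofReal_le_of_le_toReal
        (by simpa using Nat.le_ceil L)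
    _ = (((⌈L⌉₊ : ℕ) : ℕ∞) : ℝ≥0∞) := by simp
    _ ≤ (G.girth : ℝ≥0∞) := ENat.toENNReal_le.2 h1

/-- `G = M.graph` is a `k`-edge-connected multigraph (`k ≥ 1`), embedded on an orientable surface
whose genus is (at most) `γ ≥ 1`; `S` is the set of the edges that the algorithm keeps, and
`H = (M.keep S).graph`, with the dual `(M.keep S).dual`. -/
theorem lemma4p1 :
    ∃ (A : RAM.Prog) (p : Polynomial ℕ),
      ∀ (n m : ℕ) (M : EmbeddedGraph (Fin n) (Fin m)) (k γ : ℕ),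
        0 < k → 0 < γ →
        M.graph.EdgeConnected k →
        2 - 2 * (γ : ℤ) ≤ M.eulerChar →
        ∃ (μ : RAM.Store) (t : ℕ),
          RAM.Exec A (RAM.input M k γ) μ t ∧
          t ≤ p.eval (RAM.inputSize n m k γ) ∧
          let S := RAM.keptEdges m μ
          M.CycleDeletion ((k : ℝ) / (3 * √(γ : ℝ))) S ∧
          ((M.keep S).graph.numComponents : ℝ) ≤ 2 * √(γ : ℝ) ∧
          ENNReal.ofReal ((k : ℝ) / (3 * √(γ : ℝ))) ≤ ((M.keep S).dual.girth : ℝ≥0∞) := by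
  refine ⟨RAM.algorithm, RAM.timePolynomial, fun n m M k γ hk hγ hconn hχ => ?_⟩
  obtain ⟨μ, t, hexec, ht, hdel, hgirth⟩ := RAM.runs_algorithm M hk hγ
  exact ⟨μ, t, hexec, ht.trans (RAM.totalTime_le n m k γ), hdel,
    hdel.numComponents_le hk hγ hconn hχ, Graph.le_girth _ _ hgirth⟩
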